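/- Let $w\in\mathbb{C}$ be quadratic over $\mathbb{Q}$ and suppose that $\Lambda=\mathbb{Z}+\mathbb{Z}w$ is a lattice in $\mathbb{C}$. Let $E=E(\Lambda)=\mathbb{C}/\Lambda$ be the corresponding elliptic curve (which then has complex multiplication), and let $R=\operatorname{End}(E)$ be its ring of holomorphic group endomorphisms, a Noetherian integral domain with field of fractions $Q(R)$. A central elliptic arrangement $\mathcal{E}$ in $E^d$ is a list of holomorphic group homomorphisms $l_1,\dots,l_n:E^d\to E$, with hyperplanes $\ker l_i$. Write $l_i(p)=\sum_{j=1}^d a_{ij}p_j$ with $a_{ij}\in R$, and $v_i=(a_{i1},\dots,a_{id})\in R^d$. For $S\subseteq[n]$ let $m(S)$ be the number of connected components of $\bigcap_{i\in S}\ker l_i\subseteq E^d$ (which is $E^d$ for $S=\emptyset$) and let $\operatorname{rk}_{\mathcal E}(S)$ be its complex codimension in $E^d$. Bibby's elliptic Tutte polynomial is $$T^e_{\mathcal{E}}(x,y)=\sum_{S\subseteq[n]} m(S)\,(x-1)^{\operatorname{rk}_{\mathcal E}([n])-\operatorname{rk}_{\mathcal E}(S)}(y-1)^{|S|-\operatorname{rk}_{\mathcal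 E}(S)}\in\mathbb{Z}[x,y].$$ The $R$-matroid realized by $\mathcal{E}$ is $\mathcal{M}(S)=R^d/(v_i:i\in S)$ for $S\subseteq[n]$. Let $\operatorname{tor}(S)$ be the torsion submodule of $\mathcal{M}(S)$, put $\operatorname{tor}(S)^\vee=\operatorname{Hom}_R(\operatorname{tor}(S),Q(R)/R)$, and let $$\operatorname{rk}_{\mathcal M}(S)=\dim_{Q(R)}\bigl(\mathcal{M}(\emptyset)\otimes_R Q(R)\bigr)-\dim_{Q(R)}\bigl(\mathcal{M}(S)\otimes_R Q(R)\bigr)$$ be the rank of $S$ in the generic matroid of $\mathcal M$. Let $L_0(R\text{-mod})$ be the free abelian group on the isomorphism classes $[N]$ of finitely generated $R$-modules, made a ring by $[N][N']=[N\oplus N']$. The Grothendieck-Tutte polynomial of $\mathcal M$ is $$T_{\mathcal M}(x,y)=\sum_{S\subseteq[n]}[\operatorname{tor}(S)^\vee]\,(x-1)^{\operatorname{rk}_{\mathcal M}([n])-\operatorname{rk}_{\mathcal M}(S)}(y-1)^{|S|-\operatorname{rk}_{\mathcal M}(S)}\in L_0(R\text{-mod})[x,y],$$ and $\tilde T_{\mathcal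 M}(x,y)\in\mathbb{Z}[x,y]$ is its image under the ring homomorphism $\varphi:L_0(R\text{-mod})\to\mathbb{Z}$ that sends $[N]$ to the number of torsion elements of $N$ if that number is finite and to $0$ otherwise; thus $\varphi$ is $1$ on projective modules and $|N|$ on finite torsion modules, and $[\operatorname{tor}(S)^\vee]\mapsto|\operatorname{tor}(S)^\vee|$ whenever $\operatorname{tor}(S)^\vee$ is finite. Then, for every $S\subseteq[n]$, the module $\operatorname{tor}(S)$ is finite and $m(S)=|\operatorname{tor}(S)|$, and $$T^e_{\mathcal{E}}(x,y)=\tilde T_{\mathcal{M}}(x,y).$$ -/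

import Mathlib

open scoped Topology

/-! ### Matroids of modules over a commutative ring -/

/-- A matroid of modules over `R` on the ground set `Fin n`. -/
structure ModuleMatroid (R : Type) [CommRing R] (n : ℕ) where
  obj : Finset (Fin n) → FGModuleCat.{0} R
  exists_pair : ∀ (A : Finset (Fin n)) (b c : Fin n), b ∉ A → c ∉ A →
    ∃ x y : obj A,
      Nonempty (obj (insert b A) ≃ₗ[R] (obj A ⧸ Submodule.span R {x})) ∧
      Nonempty (obj (insert c A) ≃ₗ[R] (obj A ⧸ Submodule.span R {y})) ∧
      Nonempty (obj (insert b (insert c A)) ≃ₗ[R] (obj A ⧸ Submodule.span R {x, y}))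

namespace ModuleMatroid

/-- The matroid `A ↦ N / (ψ i : i ∈ A)` realized by `ψ : Fin n → N`. -/
noncomputable def realized {R : Type} [CommRing R] {n : ℕ} {N : Type} [AddCommGroup N] [Module R N]
    [Module.Finite R N] (ψ : Fin n → N) : ModuleMatroid R n where
  obj A := FGModuleCat.of R (N ⧸ Submodule.span R (ψ '' (A : Set (Fin n))))
  exists_pair A b c _ _ := by
    have key : ∀ (T : Set N) (B : Finset (Fin n)),
        Submodule.span R (ψ '' (B : Set (Fin n)))
          = Submodule.span R (ψ '' (A : Set (Fin n))) ⊔ Submodule.span R T →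
        Nonempty ((N ⧸ Submodule.span R (ψ '' (B : Set (Fin n)))) ≃ₗ[R]
          ((N ⧸ Submodule.span R (ψ '' (A : Set (Fin n)))) ⧸
            Submodule.span R ((Submodule.span R (ψ '' (A : Set (Fin n)))).mkQ '' T))) := by
      intro T B h
      refine ⟨(Submodule.quotEquivOfEq _ _ h).trans
        ((Submodule.quotientQuotientEquivQuotientSup _ _).symm.trans
          (Submodule.quotEquivOfEq _ _ ?_))⟩
      rw [Submodule.map_span]
    refine ⟨(Submodule.span R (ψ '' (A : Set (Fin n)))).mkQ (ψ b),
      (Submodule.span R (ψ '' (A : Set (Fin n)))).mkQ (ψ c), ?_, ?_, ?_⟩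
    · have := key {ψ b} (insert b A) (by
        rw [Finset.coe_insert, Set.image_insert_eq, ← Set.union_singleton, Submodule.span_union])
      rwa [Set.image_singleton] at this
    · have := key {ψ c} (insert c A) (by
        rw [Finset.coe_insert, Set.image_insert_eq, ← Set.union_singleton, Submodule.span_union])
      rwa [Set.image_singleton] at this
    · have := key {ψ b, ψ c} (insert b (insert c A)) (by
        rw [Finset.coe_insert, Finset.coe_insert, Set.image_insert_eq, Set.image_insert_eq,
          ← Submodule.span_union, Set.union_insert, Set.union_singleton])
      rwa [Set.image_pair] at this


/-- The rank of `A` in the generic matroid: the drop in dimension over the fraction field. -/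
noncomputable def rank {R : Type} [CommRing R] [IsDomain R] {n : ℕ} (M : ModuleMatroid R n)
    (A : Finset (Fin n)) : ℕ :=
  Module.finrank (FractionRing R) (TensorProduct R (FractionRing R) (M.obj ∅))
    - Module.finrank (FractionRing R) (TensorProduct R (FractionRing R) (M.obj A))

/-- The torsion submodule of `M(A)`. -/
abbrev tor {R : Type} [CommRing R] {n : ℕ} (M : ModuleMatroid R n) (A : Finset (Fin n)) :
    Submodule R (M.obj A) :=
  Submodule.torsion R (M.obj A)

end ModuleMatroid

/-! ### The ring `L₀(R-mod)` -/

/-- Isomorphism of finitely generated `R`-modules. -/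
def fgModuleSetoid (R : Type) [CommRing R] : Setoid (FGModuleCat.{0} R) where
  r M N := Nonempty (M ≃ₗ[R] N)
  iseqv :=
    { refl := fun M => ⟨LinearEquiv.refl R M⟩
      symm := fun ⟨e⟩ => ⟨e.symm⟩
      trans := fun ⟨e⟩ ⟨f⟩ => ⟨e.trans f⟩ }

/-- Isomorphism classes of finitely generated `R`-modules. -/
def FGModuleClass (R : Type) [CommRing R] : Type 1 := Quotient (fgModuleSetoid R)

namespace FGModuleClass

/-- The isomorphism class of a finitely generated module. -/
def mk (R : Type) [CommRing R] (N : Type) [AddCommGroup N] [Module R N] [Module.Finite R N] :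
    FGModuleClass R :=
  Quotient.mk (fgModuleSetoid R) (FGModuleCat.of R N)

/-- The product of two classes is the class of the direct sum. -/
noncomputable instance (R : Type) [CommRing R] : CommMonoid (FGModuleClass R) where
  mul := Quotient.map₂ (fun M N => FGModuleCat.of R (M × N))
    (fun _ _ ⟨e⟩ _ _ ⟨f⟩ => ⟨e.prodCongr f⟩)
  one := mk R PUnit
  mul_assoc := by
    rintro ⟨A⟩ ⟨B⟩ ⟨C⟩
    exact Quotient.sound ⟨LinearEquiv.prodAssoc R A B C⟩
  one_mul := by
    rintro ⟨A⟩
    exact Quotient.sound ⟨LinearEquiv.uniqueProd⟩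
  mul_one := by
    rintro ⟨A⟩
    exact Quotient.sound ⟨LinearEquiv.prodUnique⟩
  mul_comm := by
    rintro ⟨A⟩ ⟨B⟩
    exact Quotient.sound ⟨LinearEquiv.prodComm R A B⟩

/-- The torsion of a direct sum is the direct sum of the torsions. -/
lemma card_torsion_prod (R : Type) [CommRing R] [IsDomain R] (M N : Type) [AddCommGroup M]
    [AddCommGroup N] [Module R M] [Module R N] :
    Nat.card (Submodule.torsion R (M × N))
      = Nat.card (Submodule.torsion R M) * Nat.card (Submodule.torsion R N) := by
  rw [← Nat.card_prod]
  refine Nat.card_congr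
    { toFun := fun p => (⟨p.1.1, ?_⟩, ⟨p.1.2, ?_⟩)
      invFun := fun p => ⟨(p.1.1, p.2.1), ?_⟩
      left_inv := fun _ => rfl
      right_inv := fun _ => rfl }
  · obtain ⟨a, ha⟩ := p.2
    exact ⟨a, congrArg Prod.fst ha⟩
  · obtain ⟨a, ha⟩ := p.2
    exact ⟨a, congrArg Prod.snd ha⟩
  · obtain ⟨a, ha⟩ := p.1.2
    obtain ⟨b, hb⟩ := p.2.2
    refine ⟨a * b, Prod.ext ?_ ?_⟩
    · change (a * b) • p.1.1 = 0
      rw [mul_comm, mul_smul, ha, smul_zero]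
    · change (a * b) • p.2.1 = 0
      rw [mul_smul, hb, smul_zero]

/-- Isomorphic modules have equally many torsion elements. -/
lemma card_torsion_congr (R : Type) [CommRing R] (M N : Type) [AddCommGroup M]
    [AddCommGroup N] [Module R M] [Module R N] (e : M ≃ₗ[R] N) :
    Nat.card (Submodule.torsion R M) = Nat.card (Submodule.torsion R N) := by
  refine Nat.card_congr (e.toEquiv.subtypeEquiv fun x => ?_)
  change (∃ a, _) ↔ ∃ a, _
  refine exists_congr fun a => ?_
  change a • x = 0 ↔ (a : R) • e x = 0
  rw [← map_smul, LinearEquiv.map_eq_zero_iff]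
  rfl

/-- The multiplicative map sending the class of `N` to the number of its torsion elements. -/
noncomputable def torsionCard (R : Type) [CommRing R] [IsDomain R] : FGModuleClass R →* ℤ where
  toFun := Quotient.lift (fun N => (Nat.card (Submodule.torsion R N) : ℤ))
    (fun M N ⟨e⟩ => congrArg _ (card_torsion_congr R M N e))
  map_one' := by
    change ((Nat.card (Submodule.torsion R PUnit) : ℕ) : ℤ) = 1
    simp
  map_mul' := by
    rintro ⟨A⟩ ⟨B⟩
    change ((Nat.card (Submodule.torsion R (A × B)) : ℕ) : ℤ) = _
    rw [card_torsion_prod R A B, Nat.cast_mul]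

end FGModuleClass

/-- The ring `L₀(R-mod)`: the free abelian group on the isomorphism classes of finitely generated
`R`-modules, with `[M] * [N] = [M ⊕ N]`. -/
abbrev L0 (R : Type) [CommRing R] : Type 1 := MonoidAlgebra ℤ (FGModuleClass R)

/-- The element `[N]` of `L₀(R-mod)`. -/
noncomputable def L0.cls (R : Type) [CommRing R] (N : Type) [AddCommGroup N] [Module R N]
    [Module.Finite R N] : L0 R :=
  MonoidAlgebra.of ℤ (FGModuleClass R) (FGModuleClass.mk R N)

/-- The ring homomorphism `L₀(R-mod) → ℤ` with `[N] ↦ |tor N|`. -/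
noncomputable def L0.eval (R : Type) [CommRing R] [IsDomain R] : L0 R →+* ℤ :=
  (MonoidAlgebra.lift ℤ ℤ (FGModuleClass R) (FGModuleClass.torsionCard R)).toRingHom

/-- `L0.eval` is `1` on torsion-free (in particular on free and on projective) modules. -/
lemma L0.eval_cls_of_torsion_eq_bot (R : Type) [CommRing R] [IsDomain R] (N : Type)
    [AddCommGroup N] [Module R N] [Module.Finite R N] (h : Submodule.torsion R N = ⊥) :
    L0.eval R (L0.cls R N) = 1 := by
  have : L0.eval R (L0.cls R N) = (Nat.card (Submodule.torsion R N) : ℤ) :=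
    MonoidAlgebra.lift_of _ _
  rw [this, h]
  simp

/-- `L0.eval` is the cardinality on torsion modules. -/
lemma L0.eval_cls_of_torsion_eq_top (R : Type) [CommRing R] [IsDomain R] (N : Type)
    [AddCommGroup N] [Module R N] [Module.Finite R N] (h : Submodule.torsion R N = ⊤) :
    L0.eval R (L0.cls R N) = (Nat.card N : ℤ) := by
  have : L0.eval R (L0.cls R N) = (Nat.card (Submodule.torsion R N) : ℤ) :=
    MonoidAlgebra.lift_of _ _
  rw [this, h, Nat.card_congr (Submodule.topEquiv (R := R) (M := N)).toEquiv]

/-! ### The Grothendieck-Tutte polynomial -/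

/-- The module `Q(R)/R`. -/
abbrev FractionQuotient (R : Type) [CommRing R] : Type :=
  FractionRing R ⧸ LinearMap.range (Algebra.linearMap R (FractionRing R))

/-- The full dual `N^∨ = Hom(N, Q(R)/R)`. -/
abbrev FullDual (R : Type) [CommRing R] (N : Type) [AddCommGroup N] [Module R N] : Type :=
  N →ₗ[R] FractionQuotient R

/-- Over a Noetherian domain the full dual of a finitely generated torsion module is finitely
generated. -/
instance FullDual.finite_torsion (R : Type) [CommRing R] [IsDomain R] [IsNoetherianRing R]
    (M : Type) [AddCommGroup M] [Module R M] [Module.Finite R M] :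
    Module.Finite R (FullDual R (Submodule.torsion R M)) := by
  have hT : Module.IsTorsion R (Submodule.torsion R M) := Submodule.torsion_isTorsion
  obtain ⟨c, hc, hc0⟩ := Submodule.annihilator_top_inter_nonZeroDivisors hT
  have hcne : algebraMap R (FractionRing R) c ≠ 0 := by
    simpa using nonZeroDivisors.ne_zero hc0
  let φ : R →ₗ[R] FractionQuotient R :=
    (LinearMap.range (Algebra.linearMap R (FractionRing R))).mkQ.comp
      (LinearMap.toSpanSingleton R (FractionRing R) (algebraMap R (FractionRing R) c)⁻¹)
  have hφ : ∀ q : FractionQuotient R, c • q = 0 → q ∈ LinearMap.range φ := by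
    intro q hq
    obtain ⟨q, rfl⟩ := Submodule.mkQ_surjective _ q
    rw [← map_smul, Submodule.mkQ_apply, Submodule.Quotient.mk_eq_zero] at hq
    obtain ⟨r, hr⟩ := hq
    refine ⟨r, ?_⟩
    change Submodule.mkQ _ (r • (algebraMap R (FractionRing R) c)⁻¹) = _
    congr 1
    rw [Algebra.linearMap_apply, Algebra.smul_def] at hr
    rw [Algebra.smul_def, hr]
    field_simp
  have : IsNoetherian R (LinearMap.range φ) := inferInstance
  let Φ : (Submodule.torsion R M →ₗ[R] LinearMap.range φ) →ₗ[R]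
      FullDual R (Submodule.torsion R M) :=
    LinearMap.llcomp R _ _ _ (LinearMap.range φ).subtype
  refine Module.Finite.of_surjective Φ fun f => ?_
  refine ⟨f.codRestrict _ fun t => hφ _ ?_, LinearMap.ext fun _ => rfl⟩
  rw [← map_smul, (Submodule.mem_annihilator.mp hc) t trivial, map_zero]

/-- On the dual of the torsion of a finitely generated module, `L0.eval` is the cardinality. -/
lemma L0.eval_cls_fullDual (R : Type) [CommRing R] [IsDomain R] [IsNoetherianRing R]
    (M : Type) [AddCommGroup M] [Module R M] [Module.Finite R M] :
    L0.eval R (L0.cls R (FullDual R (Submodule.torsion R M)))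
      = (Nat.card (FullDual R (Submodule.torsion R M)) : ℤ) := by
  refine L0.eval_cls_of_torsion_eq_top R _ (eq_top_iff.mpr fun f _ => ?_)
  have hT : Module.IsTorsion R (Submodule.torsion R M) := Submodule.torsion_isTorsion
  obtain ⟨c, hc, hc0⟩ := Submodule.annihilator_top_inter_nonZeroDivisors hT
  refine ⟨⟨c, hc0⟩, LinearMap.ext fun t => ?_⟩
  change c • f t = 0
  rw [← map_smul, (Submodule.mem_annihilator.mp hc) t trivial, map_zero]

/-- The Grothendieck-Tutte polynomial of a matroid of modules over a Noetherian domain, in the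
variables `x = X 0`, `y = X 1`. -/
noncomputable def ModuleMatroid.grothendieckTutte {R : Type} [CommRing R] [IsDomain R]
    [IsNoetherianRing R] {n : ℕ} (M : ModuleMatroid R n) : MvPolynomial (Fin 2) (L0 R) :=
  ∑ A : Finset (Fin n), MvPolynomial.C (L0.cls R (FullDual R (M.tor A)))
    * (MvPolynomial.X 0 - 1) ^ (M.rank Finset.univ - M.rank A)
    * (MvPolynomial.X 1 - 1) ^ (A.card - M.rank A)

/-- The evaluation of the Grothendieck-Tutte polynomial in `ℤ[x, y]`. -/
noncomputable def ModuleMatroid.tildeTutte {R : Type} [CommRing R] [IsDomain R]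
    [IsNoetherianRing R] {n : ℕ} (M : ModuleMatroid R n) : MvPolynomial (Fin 2) ℤ :=
  MvPolynomial.map (L0.eval R) M.grothendieckTutte

/-! ### Elliptic curves `ℂ / Λ` and their endomorphisms -/

/-- The elliptic curve `E(Λ) = ℂ / Λ`, with the quotient topology and group structure. -/
abbrev EllipticTorus (Λ : Submodule ℤ ℂ) : Type := ℂ ⧸ Λ

namespace EllipticTorus

/-- The projection `ℂ → E(Λ)`. -/
noncomputable abbrev proj (Λ : Submodule ℤ ℂ) : ℂ →+ EllipticTorus Λ := Λ.mkQ.toAddMonoidHom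

/-- The projection `ℂ^d → E(Λ)^d`. -/
noncomputable def projPi (Λ : Submodule ℤ ℂ) (d : ℕ) : (Fin d → ℂ) →+ (Fin d → EllipticTorus Λ) where
  toFun z j := proj Λ (z j)
  map_zero' := by ext; simp
  map_add' z z' := by ext; simp

end EllipticTorus

/-- For quotients `p : V → X` and `q : W → Y` of complex vector spaces by lattices, `f : X → Y` is
holomorphic for the quotient complex structures when near every point of `V` it lifts to a
holomorphic map `g` with values in `W`. -/
def IsHolomorphicMap {V W X Y : Type} [NormedAddCommGroup V] [NormedSpace ℂ V]
    [NormedAddCommGroup W] [NormedSpace ℂ W] (p : V → X) (q : W → Y) (f : X → Y) : Prop :=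
  ∀ v : V, ∃ g : V → W, ∀ᶠ u in 𝓝 v, DifferentiableAt ℂ g u ∧ f (p u) = q (g u)

lemma IsHolomorphicMap.comp {U V W X Y Z : Type} [NormedAddCommGroup U] [NormedSpace ℂ U]
    [NormedAddCommGroup V] [NormedSpace ℂ V] [NormedAddCommGroup W] [NormedSpace ℂ W]
    {p : U → X} {q : V → Y} {r : W → Z} {f : Y → Z} {g : X → Y}
    (hf : IsHolomorphicMap q r f) (hg : IsHolomorphicMap p q g) :
    IsHolomorphicMap p r (f ∘ g) := by
  intro u
  obtain ⟨G, hG⟩ := hg u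
  obtain ⟨F, hF⟩ := hf (G u)
  refine ⟨F ∘ G, ?_⟩
  have hcont := hG.self_of_nhds.1.continuousAt
  filter_upwards [hG, hcont.eventually hF] with x hx hx'
  exact ⟨hx'.1.comp x hx.1, by rw [Function.comp_apply, hx.2, hx'.2, Function.comp_apply]⟩

/-- The ring of isogenies `End(E(Λ))`: the holomorphic group endomorphisms, with pointwise addition
and with composition as multiplication. -/
def EllipticEnd (Λ : Submodule ℤ ℂ) : Subring (AddMonoid.End (EllipticTorus Λ)) where
  carrier := {f | IsHolomorphicMap (EllipticTorus.proj Λ) (EllipticTorus.proj Λ) f}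
  mul_mem' {f g} hf hg := by
    change IsHolomorphicMap _ _ (f ∘ g)
    exact IsHolomorphicMap.comp hf hg
  one_mem' _ := ⟨id, Filter.Eventually.of_forall fun _ => ⟨differentiableAt_id, rfl⟩⟩
  zero_mem' _ := ⟨fun _ => 0, Filter.Eventually.of_forall fun _ =>
    ⟨differentiableAt_const _, (map_zero (EllipticTorus.proj Λ)).symm⟩⟩
  add_mem' {f g} hf hg v := by
    obtain ⟨F, hF⟩ := hf v
    obtain ⟨G, hG⟩ := hg v
    refine ⟨fun u => F u + G u, ?_⟩
    filter_upwards [hF, hG] with u hu hu'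
    refine ⟨hu.1.add hu'.1, ?_⟩
    rw [map_add, ← hu.2, ← hu'.2]
    rfl
  neg_mem' {f} hf v := by
    obtain ⟨F, hF⟩ := hf v
    refine ⟨fun u => -F u, ?_⟩
    filter_upwards [hF] with u hu
    refine ⟨hu.1.neg, ?_⟩
    rw [map_neg, ← hu.2]
    rfl

namespace EllipticEnd

variable {Λ : Submodule ℤ ℂ}

lemma proj_eq_iff {a b : ℂ} :
    EllipticTorus.proj Λ a = EllipticTorus.proj Λ b ↔ a - b ∈ Λ :=
  Submodule.Quotient.eq Λ

lemma exists_isolated [DiscreteTopology Λ] :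
    ∃ ε > 0, ∀ x ∈ Λ, ‖x‖ < ε → x = (0 : ℂ) := by
  obtain ⟨ε, hε, h⟩ := Metric.exists_ball_inter_eq_singleton_of_mem_discrete
    (isDiscrete_iff_discreteTopology.mpr ‹DiscreteTopology Λ›) (Λ.zero_mem)
  refine ⟨ε, hε, fun x hx hxε => ?_⟩
  have : x ∈ Metric.ball (0 : ℂ) ε ∩ Λ := ⟨by simpa using hxε, hx⟩
  rw [h] at this
  exact this

lemma eq_zero_of_forall_mul_mem [DiscreteTopology Λ] {a : ℂ} (h : ∀ z : ℂ, a * z ∈ Λ) :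
    a = 0 := by
  by_contra ha
  obtain ⟨ε, hε, h'⟩ := exists_isolated (Λ := Λ)
  have h1 := h' _ (h (a⁻¹ * ((ε / 2 : ℝ) : ℂ))) (by
    rw [mul_inv_cancel_left₀ ha, Complex.norm_real, Real.norm_eq_abs, abs_of_pos (by positivity)]
    linarith)
  rw [mul_inv_cancel_left₀ ha] at h1
  have : ε / 2 = 0 := by exact_mod_cast h1
  linarith

/-- Every isogeny is induced by multiplication by a complex number. -/
lemma exists_multiplier [DiscreteTopology Λ] (f : EllipticEnd Λ) :
    ∃ a : ℂ, ∀ z : ℂ, f.1 (EllipticTorus.proj Λ z) = EllipticTorus.proj Λ (a * z) := by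
  have hf : IsHolomorphicMap (EllipticTorus.proj Λ) (EllipticTorus.proj Λ) f.1 := f.2
  obtain ⟨g, hg⟩ := hf 0
  obtain ⟨ε, hε, hΛ⟩ := exists_isolated (Λ := Λ)
  have hg0 : EllipticTorus.proj Λ (g 0) = 0 := by
    rw [← hg.self_of_nhds.2, map_zero, map_zero]
  set h : ℂ → ℂ := fun u => g u - g 0 with hh
  have hd : HasDerivAt h (deriv g 0) 0 := (hg.self_of_nhds.1.hasDerivAt).sub_const _
  have h0 : h 0 = 0 := sub_self _
  have hsmall : ∀ᶠ u in 𝓝 (0 : ℂ), ‖h u‖ < ε / 3 := by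
    have := hd.continuousAt.norm
    rw [ContinuousAt, h0, norm_zero] at this
    exact this.eventually_lt_const (by positivity)
  obtain ⟨r, hr, hball⟩ := Metric.eventually_nhds_iff_ball.mp (hg.and hsmall)
  have hproj : ∀ u ∈ Metric.ball (0 : ℂ) r,
      f.1 (EllipticTorus.proj Λ u) = EllipticTorus.proj Λ (h u) := by
    intro u hu
    rw [(hball u hu).1.2, hh, map_sub, hg0, sub_zero]
  have hhalf : ∀ u ∈ Metric.ball (0 : ℂ) r, h u = 2 * h (u / 2) := by
    intro u hu
    have hu2 : u / 2 ∈ Metric.ball (0 : ℂ) r := by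
      rw [mem_ball_zero_iff] at hu ⊢
      rw [norm_div, Complex.norm_ofNat]
      linarith [norm_nonneg u]
    have hmem : h u - 2 * h (u / 2) ∈ Λ := by
      rw [← proj_eq_iff, two_mul, map_add, ← hproj u hu, ← hproj _ hu2, ← map_add, ← map_add,
        add_halves]
    have hnorm : ‖h u - 2 * h (u / 2)‖ < ε := by
      have h1 := (hball u hu).2
      have h2 := (hball _ hu2).2
      calc ‖h u - 2 * h (u / 2)‖ ≤ ‖h u‖ + ‖2 * h (u / 2)‖ := norm_sub_le _ _
        _ = ‖h u‖ + 2 * ‖h (u / 2)‖ := by rw [norm_mul, Complex.norm_ofNat]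
        _ < ε := by linarith
    exact sub_eq_zero.mp (hΛ _ hmem hnorm)
  have hball2 : ∀ u ∈ Metric.ball (0 : ℂ) r, ∀ k : ℕ,
      u / 2 ^ k ∈ Metric.ball (0 : ℂ) r := by
    intro u hu k
    rw [mem_ball_zero_iff] at hu ⊢
    rw [norm_div, norm_pow, Complex.norm_ofNat]
    exact (div_le_self (norm_nonneg u) (one_le_pow₀ (by norm_num))).trans_lt hu
  have hpow : ∀ u ∈ Metric.ball (0 : ℂ) r, ∀ k : ℕ, h u = 2 ^ k * h (u / 2 ^ k) := by
    intro u hu k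
    induction k with
    | zero => simp
    | succ k ih =>
      rw [ih, hhalf _ (hball2 u hu k), pow_succ, div_div, mul_assoc]
  have hlin : ∀ u ∈ Metric.ball (0 : ℂ) r, h u = deriv g 0 * u := by
    intro u hu
    have hd' : HasDerivAt (fun t : ℂ => h (t * u)) (deriv g 0 * u) 0 := by
      have h1 : HasDerivAt (fun t : ℂ => t * u) u 0 := by
        simpa using (hasDerivAt_id (0 : ℂ)).mul_const u
      have h2 : HasDerivAt h (deriv g 0) ((0 : ℂ) * u) := by rwa [zero_mul]
      exact h2.comp (0 : ℂ) h1
    have hs := hd'.tendsto_slope_zero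
    have ht : Filter.Tendsto (fun k : ℕ => ((1 / 2 : ℂ)) ^ k) Filter.atTop (𝓝[≠] 0) := by
      refine tendsto_nhdsWithin_iff.mpr ⟨tendsto_pow_atTop_nhds_zero_of_norm_lt_one ?_,
        Filter.Eventually.of_forall fun k => ?_⟩
      · norm_num
      · exact pow_ne_zero k (by norm_num)
    refine tendsto_nhds_unique (tendsto_const_nhds (x := h u)) ((hs.comp ht).congr fun k => ?_)
    have hk := hpow u hu k
    have e : (1 / 2 : ℂ) ^ k * u = u / 2 ^ k := by
      rw [one_div, inv_pow, mul_comm, div_eq_mul_inv]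
    simp only [Function.comp_apply, zero_add, zero_mul, h0, sub_zero, smul_eq_mul, e]
    rw [one_div, inv_pow, inv_inv, ← hk]
  refine ⟨deriv g 0, fun z => ?_⟩
  obtain ⟨m, hm⟩ := exists_nat_gt (‖z‖ / r)
  have hmpos : (0 : ℝ) < m := lt_of_le_of_lt (by positivity) hm
  have hm0 : (m : ℂ) ≠ 0 := by
    have := hmpos.ne'
    exact_mod_cast this
  have hzm : z / m ∈ Metric.ball (0 : ℂ) r := by
    rw [mem_ball_zero_iff, norm_div, Complex.norm_natCast, div_lt_iff₀ hmpos]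
    rw [div_lt_iff₀ hr] at hm
    linarith
  have hz : z = m • (z / m) := by
    rw [nsmul_eq_mul]
    field_simp
  conv_lhs => rw [hz]
  rw [map_nsmul, map_nsmul, hproj _ hzm, hlin _ hzm, ← map_nsmul, nsmul_eq_mul]
  congr 1
  field_simp

/-- The complex multiplier of an isogeny. -/
noncomputable def multiplier [DiscreteTopology Λ] (f : EllipticEnd Λ) : ℂ :=
  (exists_multiplier f).choose

lemma multiplier_spec [DiscreteTopology Λ] (f : EllipticEnd Λ) (z : ℂ) :
    f.1 (EllipticTorus.proj Λ z) = EllipticTorus.proj Λ (multiplier f * z) :=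
  (exists_multiplier f).choose_spec z

lemma ext_proj {f g : EllipticEnd Λ}
    (h : ∀ z, f.1 (EllipticTorus.proj Λ z) = g.1 (EllipticTorus.proj Λ z)) : f = g := by
  refine Subtype.ext (AddMonoidHom.ext fun x => ?_)
  obtain ⟨z, rfl⟩ := Submodule.mkQ_surjective Λ x
  exact h z

lemma multiplier_eq [DiscreteTopology Λ] {f : EllipticEnd Λ} {a : ℂ}
    (h : ∀ z, f.1 (EllipticTorus.proj Λ z) = EllipticTorus.proj Λ (a * z)) :
    multiplier f = a := by
  refine sub_eq_zero.mp (eq_zero_of_forall_mul_mem (Λ := Λ) fun z => ?_)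
  rw [sub_mul, ← proj_eq_iff, ← multiplier_spec, h]

noncomputable instance [DiscreteTopology Λ] : CommRing (EllipticEnd Λ) where
  mul_comm f g := ext_proj fun z => by
    change f.1 (g.1 _) = g.1 (f.1 _)
    rw [multiplier_spec, multiplier_spec, multiplier_spec, multiplier_spec]
    congr 1
    ring

/-- Isogenies embed into `ℂ` by their multipliers. -/
noncomputable def multiplierHom (Λ : Submodule ℤ ℂ) [DiscreteTopology Λ] : EllipticEnd Λ →+* ℂ where
  toFun := multiplier
  map_one' := multiplier_eq fun z => by rw [one_mul]; rfl
  map_zero' := multiplier_eq fun z => by rw [zero_mul, map_zero]; rfl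
  map_mul' f g := multiplier_eq fun z => by
    change f.1 (g.1 _) = _
    rw [multiplier_spec, multiplier_spec, mul_assoc]
  map_add' f g := multiplier_eq fun z => by
    change f.1 _ + g.1 _ = _
    rw [multiplier_spec, multiplier_spec, ← map_add, add_mul]

lemma multiplierHom_injective [DiscreteTopology Λ] :
    Function.Injective (multiplierHom Λ) := by
  intro f g h
  refine ext_proj fun z => ?_
  rw [multiplier_spec, multiplier_spec]
  congr 2

instance [DiscreteTopology Λ] : IsDomain (EllipticEnd Λ) :=
  multiplierHom_injective.isDomain (multiplierHom Λ)

instance [DiscreteTopology Λ] [IsZLattice ℝ Λ] : IsNoetherianRing (EllipticEnd Λ) := by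
  have : Module.Finite ℤ Λ := ZLattice.module_finite ℝ Λ
  obtain ⟨x, hx, hx0⟩ : ∃ x ∈ Λ, x ≠ 0 := by
    refine (Submodule.ne_bot_iff Λ).mp ?_
    rintro rfl
    have h := IsZLattice.span_top (K := ℝ) (L := (⊥ : Submodule ℤ ℂ))
    rw [Submodule.bot_coe, Submodule.span_zero_singleton] at h
    exact bot_ne_top h
  have hmem : ∀ f : EllipticEnd Λ, multiplierHom Λ f * x ∈ Λ := by
    intro f
    have h1 : EllipticTorus.proj Λ x = 0 := (Submodule.Quotient.mk_eq_zero Λ).mpr hx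
    have h2 := multiplier_spec f x
    rw [h1, map_zero] at h2
    exact (Submodule.Quotient.mk_eq_zero Λ).mp h2.symm
  let φ : EllipticEnd Λ →+ Λ :=
    { toFun := fun f => ⟨multiplierHom Λ f * x, hmem f⟩
      map_zero' := Subtype.ext (by simp)
      map_add' := fun f g => Subtype.ext (by simp [add_mul]) }
  have hφ : Function.Injective φ := by
    intro f g h
    exact multiplierHom_injective (mul_right_cancel₀ hx0 (congrArg Subtype.val h))
  have : IsNoetherian ℤ (EllipticEnd Λ) :=
    isNoetherian_of_injective φ.toIntLinearMap hφ
  exact isNoetherian_of_tower ℤ this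

end EllipticEnd

/-! ### Elliptic arrangements -/

/-- The holomorphic group homomorphisms `E(Λ)^d → E(Λ)`. -/
def EllipticHom (Λ : Submodule ℤ ℂ) (d : ℕ) : Type :=
  {f : (Fin d → EllipticTorus Λ) →+ EllipticTorus Λ //
    IsHolomorphicMap (EllipticTorus.projPi Λ d) (EllipticTorus.proj Λ) f}

/-- The `j`-th coefficient `a_j ∈ End(E(Λ))` of `f : E(Λ)^d → E(Λ)`, so that
`f p = a_0 p_0 + ⋯ + a_(d-1) p_(d-1)`. -/
noncomputable def EllipticHom.coeff {Λ : Submodule ℤ ℂ} {d : ℕ} (f : EllipticHom Λ d) (j : Fin d) :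
    EllipticEnd Λ :=
  ⟨f.1.comp (AddMonoidHom.single (fun _ : Fin d => EllipticTorus Λ) j), by
    have hs : IsHolomorphicMap (EllipticTorus.proj Λ) (EllipticTorus.projPi Λ d)
        (AddMonoidHom.single (fun _ : Fin d => EllipticTorus Λ) j) := by
      intro v
      refine ⟨fun u => ContinuousLinearMap.single ℂ (fun _ : Fin d => ℂ) j u,
        Filter.Eventually.of_forall fun u => ⟨ContinuousLinearMap.differentiableAt _, ?_⟩⟩
      ext i
      by_cases h : i = j
      · subst h
        simp [EllipticTorus.projPi]
      · simp [EllipticTorus.projPi, h]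
    change IsHolomorphicMap _ _ (f.1 ∘ AddMonoidHom.single (fun _ : Fin d => EllipticTorus Λ) j)
    exact f.2.comp hs⟩

lemma EllipticHom.apply_eq_sum {Λ : Submodule ℤ ℂ} {d : ℕ} (f : EllipticHom Λ d)
    (p : Fin d → EllipticTorus Λ) : f.1 p = ∑ j, (f.coeff j).1 (p j) := by
  conv_lhs => rw [← Finset.univ_sum_single p]
  rw [map_sum]
  rfl

/-- A central elliptic arrangement in `E(Λ)^d`: a list of `n` holomorphic homomorphisms
`l_i : E(Λ)^d → E(Λ)`, with hyperplanes `ker l_i`. -/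
abbrev EllipticArrangement (Λ : Submodule ℤ ℂ) (d n : ℕ) : Type := Fin n → EllipticHom Λ d

namespace EllipticArrangement

variable {Λ : Submodule ℤ ℂ} {d n : ℕ}

/-- The intersection of the hyperplanes `ker l_i`, `i ∈ S`, in `E(Λ)^d`. -/
def inter (l : EllipticArrangement Λ d n) (S : Finset (Fin n)) :
    AddSubgroup (Fin d → EllipticTorus Λ) :=
  ⨅ i ∈ S, (l i).1.ker

/-- The number of connected components of the intersection, in the subspace topology. -/
noncomputable def mult (l : EllipticArrangement Λ d n) (S : Finset (Fin n)) : ℕ :=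
  Nat.card (ConnectedComponents (l.inter S))

/-- The tangent space at the origin of a complex subgroup `H` of `E(Λ)^d`: the vectors whose complex
one-parameter subgroup lies in `H`. -/
def tangentSpace (H : AddSubgroup (Fin d → EllipticTorus Λ)) : Submodule ℂ (Fin d → ℂ) where
  carrier := {v | ∀ t : ℂ, EllipticTorus.projPi Λ d (t • v) ∈ H}
  zero_mem' t := by
    rw [smul_zero, map_zero]
    exact H.zero_mem
  add_mem' hv hw t := by
    rw [smul_add, map_add]
    exact H.add_mem (hv t) (hw t)
  smul_mem' c v hv t := by
    rw [smul_smul]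
    exact hv (t * c)

/-- The complex codimension of the intersection of the hyperplanes in `S`. -/
noncomputable def rank (l : EllipticArrangement Λ d n) (S : Finset (Fin n)) : ℕ :=
  d - Module.finrank ℂ (tangentSpace (l.inter S))

/-- The elliptic Tutte polynomial, in the variables `x = X 0`, `y = X 1`. -/
noncomputable def ellipticTutte (l : EllipticArrangement Λ d n) : MvPolynomial (Fin 2) ℤ :=
  ∑ S : Finset (Fin n), MvPolynomial.C (l.mult S : ℤ)
    * (MvPolynomial.X 0 - 1) ^ (l.rank Finset.univ - l.rank S)
    * (MvPolynomial.X 1 - 1) ^ (S.card - l.rank S)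

/-- The matroid over `End(E(Λ))` realized by the arrangement: the coefficient vectors
`(a_0, …, a_(d-1))` of the `l_i` in the free module `End(E(Λ))^d`. -/
noncomputable def matroid [DiscreteTopology Λ] (l : EllipticArrangement Λ d n) :
    ModuleMatroid (EllipticEnd Λ) n :=
  ModuleMatroid.realized (N := Fin d → EllipticEnd Λ) fun i j => (l i).coeff j

end EllipticArrangement

/-! Let `A` be the matrix over `R = End(E)` of the coefficients of the `l_i`, `i ∈ S`. A point with
lift `z` lies in the intersection exactly when `A z ∈ Λ^S`. The class of `A z` modulo `A Λ^d` is
locally constant, since `Λ` is discrete. Two points with the same class are joined by a segment in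
the direction of `ker A`, and the classes that occur are exactly the torsion ones. So `m(S)` counts
the torsion of the cokernel of `A` on `Λ^d` (`mult_eq_card_torsion`), whereas `M(S)` is the cokernel
of the transpose of `A` on powers of `R`. Two changes are needed.

From `Λ` to `R`: if `a w² + b w + c = 0` is primitive, then `R = ℤ[a w]` (`exists_generator`) and
`Λ` is locally isomorphic to `R`. Concretely, multiplication by `x + y w` and by `a` times its
conjugate give maps `R → Λ → R` whose composites are the integer `a x² - b x y + c y²`
(`exists_latticeModule_maps`). This integer can be made coprime to any given one
(`exists_isCoprime_quadratic_form`), hence to both torsion orders, which must then agree.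

From `A` to its transpose: the coefficient of `a w` identifies `R` with its `ℤ`-dual, so `R` is
Gorenstein. This bounds `|T^∨|` by `|T|` for finite `T` (`card_fullDual_le`) and embeds the torsion
for `A` into the full dual of the torsion for the transpose (`card_torsion_coker_le`). Applied to
both matrices, these inequalities form a cycle, so all are equalities
(`card_torsion_coker_transpose`).

The exponents agree because the tangent space of the intersection is `ker A = Hom_R(M(S), ℂ)`, whose
dimension is the rank of `M(S)`. -/

/-! ### Torsion of cokernels of matrices -/

section Coker

variable {R : Type} [CommRing R] {ι κ : Type} [Fintype κ]

/-- The linear map `P^κ → P^ι` given by a matrix with entries in `R`, for an `R`-module `P`. -/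
def Matrix.actOn (A : Matrix ι κ R) (P : Type) [AddCommGroup P] [Module R P] :
    (κ → P) →ₗ[R] (ι → P) :=
  LinearMap.pi fun i => ∑ j, A i j • LinearMap.proj j

lemma Matrix.actOn_apply (A : Matrix ι κ R) (P : Type) [AddCommGroup P] [Module R P]
    (x : κ → P) (i : ι) : A.actOn P x i = ∑ j, A i j • x j := by
  simp [Matrix.actOn]

/-- The cokernel of the action of a matrix on powers of `P`. -/
abbrev Matrix.Coker (A : Matrix ι κ R) (P : Type) [AddCommGroup P] [Module R P] : Type :=
  (ι → P) ⧸ LinearMap.range (A.actOn P)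

lemma Matrix.compLeft_actOn (A : Matrix ι κ R) {P Q : Type} [AddCommGroup P] [Module R P]
    [AddCommGroup Q] [Module R Q] (f : P →ₗ[R] Q) (x : κ → P) :
    f.compLeft ι (A.actOn P x) = A.actOn Q (f.compLeft κ x) := by
  ext i
  simp [Matrix.actOn_apply]

/-- The map induced on cokernels by a linear map of coefficient modules. -/
def Matrix.cokerMap (A : Matrix ι κ R) {P Q : Type} [AddCommGroup P] [Module R P]
    [AddCommGroup Q] [Module R Q] (f : P →ₗ[R] Q) : A.Coker P →ₗ[R] A.Coker Q :=
  Submodule.mapQ _ _ (f.compLeft ι) (by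
    rintro _ ⟨x, rfl⟩
    exact ⟨f.compLeft κ x, (A.compLeft_actOn f x).symm⟩)

/-- A map with a left inverse up to an integer coprime to the torsion does not lose torsion. -/
lemma card_torsion_le_of_comp_eq_smul {X Y : Type} [AddCommGroup X] [AddCommGroup Y] [Module R X]
    [Module R Y] [Finite (Submodule.torsion R Y)] (F : X →ₗ[R] Y) (G : Y →ₗ[R] X) (m : ℤ)
    (h : ∀ x, G (F x) = m • x) (hm : IsCoprime m (Nat.card (Submodule.torsion R X) : ℤ)) :
    Nat.card (Submodule.torsion R X) ≤ Nat.card (Submodule.torsion R Y) := by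
  have hF : ∀ x ∈ Submodule.torsion R X, F x ∈ Submodule.torsion R Y := by
    rintro x ⟨a, ha⟩
    exact ⟨a, by rw [Submonoid.smul_def, ← map_smul, ← Submonoid.smul_def, ha, map_zero]⟩
  -- A torsion element killed by `F` is killed by `m` and by the order of the torsion, which are
  -- coprime.
  refine Nat.card_le_card_of_injective (F.restrict hF) ?_
  rw [injective_iff_map_eq_zero]
  intro x hx
  have hx0 : F x = 0 := congrArg Subtype.val hx
  have h1 : m • x = 0 := Subtype.ext (by
    rw [Submodule.coe_smul_of_tower, ← h, hx0, map_zero]; rfl)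
  have h2 : (Nat.card (Submodule.torsion R X) : ℤ) • x = 0 := by
    rw [natCast_zsmul]; exact card_nsmul_eq_zero'
  obtain ⟨a, b, hab⟩ := hm
  rw [← one_zsmul x, ← hab, add_smul, mul_smul, mul_smul, h1, h2, smul_zero, smul_zero, add_zero]

lemma Matrix.cokerMap_cokerMap (A : Matrix ι κ R) {P Q : Type} [AddCommGroup P] [Module R P]
    [AddCommGroup Q] [Module R Q] (f : P →ₗ[R] Q) (g : Q →ₗ[R] P) (m : ℤ)
    (h : ∀ x, g (f x) = m • x) (c : A.Coker P) : A.cokerMap g (A.cokerMap f c) = m • c := by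
  obtain ⟨u, rfl⟩ := Submodule.mkQ_surjective _ c
  rw [← map_zsmul]
  change Submodule.mkQ _ _ = _
  congr 1
  ext i
  exact h (u i)

/-- Coefficient modules related by maps that are mutually inverse up to a suitable integer give
equally many torsion elements in the cokernel. -/
lemma Matrix.card_torsion_coker_eq (A : Matrix ι κ R) {P Q : Type} [AddCommGroup P] [Module R P]
    [AddCommGroup Q] [Module R Q] [Finite (Submodule.torsion R (A.Coker P))]
    [Finite (Submodule.torsion R (A.Coker Q))] (f : P →ₗ[R] Q) (g : Q →ₗ[R] P) (m : ℤ)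
    (hgf : ∀ x, g (f x) = m • x) (hfg : ∀ x, f (g x) = m • x)
    (hP : IsCoprime m (Nat.card (Submodule.torsion R (A.Coker P)) : ℤ))
    (hQ : IsCoprime m (Nat.card (Submodule.torsion R (A.Coker Q)) : ℤ)) :
    Nat.card (Submodule.torsion R (A.Coker P)) = Nat.card (Submodule.torsion R (A.Coker Q)) :=
  le_antisymm
    (card_torsion_le_of_comp_eq_smul _ _ m (A.cokerMap_cokerMap f g m hgf) hP)
    (card_torsion_le_of_comp_eq_smul _ _ m (A.cokerMap_cokerMap g f m hfg) hQ)

end Coker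

/-! ### Finiteness of torsion over rings finite over `ℤ` -/

section FiniteOverInt

variable {R : Type} [CommRing R] [IsDomain R] [Module.Finite ℤ R]

/-- By integrality over `ℤ`, a nonzero ideal contracts to a nonzero ideal of `ℤ`. This turns
`R`-torsion into `ℤ`-torsion. -/
lemma exists_int_mul_eq {a : R} (ha : a ≠ 0) : ∃ k : ℤ, k ≠ 0 ∧ ∃ b : R, b * a = k := by
  have h := Ideal.comap_ne_bot_of_integral_mem (R := ℤ) (I := Ideal.span {a}) ha
    (Ideal.mem_span_singleton_self a) (Algebra.IsIntegral.isIntegral a)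
  obtain ⟨k, hk, hk0⟩ := (Submodule.ne_bot_iff _).mp h
  rw [Ideal.mem_comap, Ideal.mem_span_singleton'] at hk
  exact ⟨k, hk0, hk⟩

/-- Torsion submodules are finite over a domain of characteristic zero finite over `ℤ`. -/
lemma finite_torsion_of_finite_int (X : Type) [AddCommGroup X] [Module R X] [Module.Finite R X] :
    Finite (Submodule.torsion R X) := by
  have : Module.Finite ℤ X := Module.Finite.trans R X
  have : Module.Finite ℤ (Submodule.torsion R X) :=
    inferInstanceAs (Module.Finite ℤ ((Submodule.torsion R X).restrictScalars ℤ))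
  refine Module.finite_of_fg_torsion _ ?_
  rintro ⟨x, a, ha⟩
  obtain ⟨k, hk, b, hb⟩ := exists_int_mul_eq (nonZeroDivisors.ne_zero a.2)
  refine ⟨⟨k, mem_nonZeroDivisors_of_ne_zero hk⟩, Subtype.ext ?_⟩
  change k • x = 0
  rw [← Int.cast_smul_eq_zsmul R, ← hb, mul_smul]
  change b • (a • x) = 0
  rw [ha, smul_zero]

end FiniteOverInt

/-! ### Frobenius forms and duality -/

/-- A functional `φ` identifying `R` with its `ℤ`-dual. -/
structure IsFrobeniusForm {R : Type} [CommRing R] (φ : R →ₗ[ℤ] ℤ) : Prop where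
  exists_eq : ∀ ψ : R →ₗ[ℤ] ℤ, ∃ s : R, ∀ r, ψ r = φ (s * r)
  eq_zero : ∀ a : R, (∀ r, φ (a * r) = 0) → a = 0

namespace IsFrobeniusForm

variable {R : Type} [CommRing R] {φ : R →ₗ[ℤ] ℤ}

/-- The quotient `r ↦ φ (c * r) / N` is again `ℤ`-linear, hence of the form `φ (s * ·)`;
nondegeneracy then forces `c = N * s`. -/
lemma exists_eq_mul_of_dvd (hφ : IsFrobeniusForm φ) {N : ℤ} (hN : N ≠ 0) {c : R}
    (h : ∀ r, N ∣ φ (c * r)) : ∃ s : R, c = N * s := by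
  choose q hq using h
  let ψ : R →ₗ[ℤ] ℤ :=
    { toFun := q
      map_add' := fun r r' => mul_left_cancel₀ hN (by
        rw [mul_add, ← hq, ← hq, ← hq, mul_add, map_add])
      map_smul' := fun k r => mul_left_cancel₀ hN (by
        rw [← hq, mul_smul_comm, map_smul, hq]
        simp only [smul_eq_mul, eq_intCast, Int.cast_id]
        ring) }
  obtain ⟨s, hs⟩ := hφ.exists_eq ψ
  refine ⟨s, sub_eq_zero.mp (hφ.eq_zero _ fun r => ?_)⟩
  have h1 : (N * s : R) * r = N • (s * r) := by rw [zsmul_eq_mul, mul_assoc]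
  rw [sub_mul, map_sub, h1, map_smul, ← hs, hq, smul_eq_mul]
  exact sub_self _

/-- A functional on a saturated submodule of a free module extends to the free module. -/
lemma exists_extension [Module.Finite ℤ R] {κ : Type} [Fintype κ] (hφ : IsFrobeniusForm φ)
    (L : Submodule R (κ → R)) (hL : ∀ (k : ℤ) (v : κ → R), k ≠ 0 → k • v ∈ L → v ∈ L)
    (h : L →ₗ[R] R) : ∃ x : κ → R, ∀ v : L, h v = ∑ j, x j * v.1 j := by
  classical
  -- Saturation makes the quotient a finitely generated torsion-free, hence free, abelian group. So
  -- `L` is a direct summand over `ℤ`, though perhaps not over `R`.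
  have : Module.IsTorsionFree ℤ ((κ → R) ⧸ L.restrictScalars ℤ) := by
    refine .of_smul_eq_zero fun k v hkv => ?_
    obtain ⟨v, rfl⟩ := Submodule.mkQ_surjective _ v
    rw [← map_smul, Submodule.mkQ_apply, Submodule.Quotient.mk_eq_zero] at hkv
    refine or_iff_not_imp_left.mpr fun hk => ?_
    rw [Submodule.mkQ_apply, Submodule.Quotient.mk_eq_zero]
    exact hL k v hk hkv
  obtain ⟨s, hs⟩ := Module.projective_lifting_property (L.restrictScalars ℤ).mkQ LinearMap.id
    (Submodule.mkQ_surjective _)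
  have hs' : ∀ y, (L.restrictScalars ℤ).mkQ (s y) = y := fun y => LinearMap.congr_fun hs y
  let p : (κ → R) →ₗ[ℤ] L.restrictScalars ℤ :=
    (LinearMap.id - s ∘ₗ (L.restrictScalars ℤ).mkQ).codRestrict _ fun v => by
      rw [← Submodule.Quotient.mk_eq_zero, ← Submodule.mkQ_apply]
      simp only [LinearMap.sub_apply, LinearMap.id_apply, LinearMap.comp_apply, map_sub, hs',
        sub_self]
  have hp : ∀ v : L, p v.1 = v := by
    intro v
    refine Subtype.ext ?_
    have : (L.restrictScalars ℤ).mkQ v.1 = 0 := (Submodule.Quotient.mk_eq_zero _).mpr v.2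
    simp [p, LinearMap.codRestrict_apply, this]
  -- The projection `p` is only `ℤ`-linear; representing `φ ∘ h ∘ p` by `φ` coordinate by coordinate
  -- restores `R`-linearity.
  let ψ : (κ → R) →ₗ[ℤ] ℤ := φ ∘ₗ (h.restrictScalars ℤ) ∘ₗ p
  choose x hx using fun j => hφ.exists_eq (ψ ∘ₗ LinearMap.single ℤ (fun _ : κ => R) j)
  have hψ : ∀ v, ψ v = φ (∑ j, x j * v j) := by
    intro v
    conv_lhs => rw [← Finset.univ_sum_single v]
    rw [map_sum, map_sum]
    exact Finset.sum_congr rfl fun j _ => hx j (v j)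
  refine ⟨x, fun v => sub_eq_zero.mp (hφ.eq_zero _ fun r => ?_)⟩
  have h1 : ψ (r • v).1 = φ (h (r • v)) := by
    change φ (h (p (r • v).1)) = _
    rw [hp]
  rw [hψ, map_smul] at h1
  rw [sub_mul, map_sub, mul_comm _ r, ← smul_eq_mul, ← h1, sub_eq_zero]
  congr 1
  rw [Finset.sum_mul]
  refine Finset.sum_congr rfl fun j _ => ?_
  change x j * (r * v.1 j) = _
  ring

end IsFrobeniusForm

/-! ### The duality pairing between a cokernel and the cokernel of the transpose -/

namespace Matrix

variable {R : Type} [CommRing R] [IsDomain R]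

/-- The functional `v ↦ ⟨x, v⟩ / k` modulo `R` on the cokernel of the transpose, for `A x = k u`. -/
noncomputable def cokerDual {ι κ : Type} [Fintype ι] [Fintype κ] (A : Matrix ι κ R)
    {k : R} (hk : k ≠ 0) {u : ι → R} {x : κ → R} (hu : k • u = A.actOn R x) :
    FullDual R (A.transpose.Coker R) :=
  Submodule.liftQ _
    ((Submodule.mkQ _).comp ((LinearMap.toSpanSingleton R (FractionRing R)
      (algebraMap R (FractionRing R) k)⁻¹).comp (Fintype.linearCombination R x))) (by
    rintro _ ⟨y, rfl⟩
    have hk' : algebraMap R (FractionRing R) k ≠ 0 := by simpa using hk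
    -- Moving `A` across the pairing, `⟨x, Aᵀ y⟩ = ⟨A x, y⟩ = k ⟨u, y⟩`, so division by `k` lands in
    -- `R` on all relations.
    have h1 : Fintype.linearCombination R x (A.transpose.actOn R y) = k * ∑ i, u i * y i := by
      have hu' : ∀ i, k * u i = ∑ j, A i j * x j := fun i => by
        simpa [Matrix.actOn_apply] using congrFun hu i
      simp only [Fintype.linearCombination_apply, Matrix.actOn_apply, smul_eq_mul,
        Matrix.transpose_apply, Finset.mul_sum, Finset.sum_mul, ← mul_assoc, hu']
      rw [Finset.sum_comm]
      exact Finset.sum_congr rfl fun i _ => Finset.sum_congr rfl fun j _ => by ring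
    rw [LinearMap.mem_ker, LinearMap.comp_apply, LinearMap.comp_apply, h1, Submodule.mkQ_apply,
      Submodule.Quotient.mk_eq_zero]
    refine ⟨∑ i, u i * y i, ?_⟩
    rw [LinearMap.toSpanSingleton_apply, Algebra.smul_def, map_mul, mul_comm, ← mul_assoc,
      inv_mul_cancel₀ hk', one_mul, Algebra.linearMap_apply])

lemma cokerDual_mk {ι κ : Type} [Fintype ι] [Fintype κ] (A : Matrix ι κ R)
    {k : R} (hk : k ≠ 0) {u : ι → R} {x : κ → R} (hu : k • u = A.actOn R x) (v : κ → R) :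
    A.cokerDual hk hu (Submodule.Quotient.mk v) = Submodule.Quotient.mk
      (algebraMap R (FractionRing R) (∑ j, x j * v j) / algebraMap R (FractionRing R) k) := by
  change Submodule.Quotient.mk
    (Fintype.linearCombination R x v • (algebraMap R (FractionRing R) k)⁻¹) = _
  rw [Algebra.smul_def, ← div_eq_mul_inv, Fintype.linearCombination_apply]
  simp only [smul_eq_mul, mul_comm]

end Matrix

namespace IsFrobeniusForm

variable {R : Type} [CommRing R] [IsDomain R] [CharZero R] {φ : R →ₗ[ℤ] ℤ}

/-- The preimage `L` of the torsion is saturated and contains the rows of `A`. On `L` the functional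
`⟨x, ·⟩ / k` has values in `R`, so it extends to some `⟨x', ·⟩` on the whole free module; evaluation
on the rows gives `A x' = u`. This is the injectivity of the pairing. -/
lemma mem_range_of_mul_dvd_pairing [Module.Finite ℤ R] (hφ : IsFrobeniusForm φ) {ι κ : Type} [Fintype ι]
    [Fintype κ] (A : Matrix ι κ R) {k : R} (hk : k ≠ 0) {u : ι → R} {x : κ → R}
    (hu : k • u = A.actOn R x)
    (h : ∀ v : κ → R, Submodule.Quotient.mk v ∈ Submodule.torsion R (A.transpose.Coker R) →
      ∃ r, ∑ j, x j * v j = k * r) : u ∈ LinearMap.range (A.actOn R) := by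
  classical
  let L : Submodule R (κ → R) :=
    (Submodule.torsion R (A.transpose.Coker R)).comap (Submodule.mkQ _)
  have hrange : ∀ y : ι → R, A.transpose.actOn R y ∈ L := fun y => by
    have : (LinearMap.range (A.transpose.actOn R)).mkQ (A.transpose.actOn R y) = 0 :=
      (Submodule.Quotient.mk_eq_zero _).mpr ⟨y, rfl⟩
    rw [Submodule.mem_comap, this]
    exact Submodule.zero_mem _
  have hL : ∀ (m : ℤ) (v : κ → R), m ≠ 0 → m • v ∈ L → v ∈ L := by
    rintro m v hm ⟨a, ha⟩
    have hm' : (m : R) ∈ nonZeroDivisors R :=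
      mem_nonZeroDivisors_of_ne_zero (Int.cast_ne_zero.mpr hm)
    refine ⟨a * ⟨m, hm'⟩, ?_⟩
    rw [mul_smul]
    rw [map_zsmul, ← Int.cast_smul_eq_zsmul R] at ha
    exact ha
  choose q hq using fun v : L => h v.1 v.2
  let f : L →ₗ[R] R :=
    { toFun := q
      map_add' := fun v w => mul_left_cancel₀ hk (by
        rw [← hq, mul_add, ← hq, ← hq, ← Finset.sum_add_distrib]
        exact Finset.sum_congr rfl fun j _ => mul_add _ _ _)
      map_smul' := fun r v => mul_left_cancel₀ hk (by
        rw [← hq, RingHom.id_apply, smul_eq_mul, mul_left_comm, ← hq, Finset.mul_sum]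
        exact Finset.sum_congr rfl fun j _ => mul_left_comm _ _ _) }
  obtain ⟨x', hx'⟩ := hφ.exists_extension L hL f
  refine ⟨x', funext fun i => mul_left_cancel₀ hk ?_⟩
  have h1 := hq ⟨_, hrange (Pi.single i 1)⟩
  have h2 := hx' ⟨_, hrange (Pi.single i 1)⟩
  have h3 : ∀ j, A.transpose.actOn R (Pi.single i 1) j = A i j := fun j => by
    simp [Matrix.actOn_apply, Pi.single_apply]
  simp only [h3] at h1 h2
  have h4 : k * u i = ∑ j, A i j * x j := by
    simpa [Matrix.actOn_apply] using congrFun hu i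
  rw [h4, Matrix.actOn_apply]
  simp only [smul_eq_mul, mul_comm (A i _)]
  rw [h1, ← h2]
  rfl

end IsFrobeniusForm

/-- As `N = |T|` kills `T`, a functional has values `a / N` modulo `R`, and `φ(a)` modulo `N` is a
character of the group `T`. The functional is recovered from this character, and `T` has exactly
`|T|` complex characters. -/
lemma IsFrobeniusForm.card_fullDual_le {R : Type} [CommRing R] [IsDomain R] [CharZero R]
    {φ : R →ₗ[ℤ] ℤ} (hφ : IsFrobeniusForm φ) (T : Type) [AddCommGroup T] [Module R T] [Finite T] :
    Finite (FullDual R T) ∧ Nat.card (FullDual R T) ≤ Nat.card T := by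
  have : NeZero (Nat.card T) := ⟨Nat.card_pos.ne'⟩
  set N : ℕ := Nat.card T with hNdef
  have hN0 : (N : R) ≠ 0 := NeZero.ne _
  have hNK : algebraMap R (FractionRing R) N ≠ 0 := by simpa using hN0
  have hmk : ∀ (a b : R), (Submodule.Quotient.mk (algebraMap R (FractionRing R) a / algebraMap R _ N) :
      FractionQuotient R) = Submodule.Quotient.mk (algebraMap R (FractionRing R) b / algebraMap R _ N)
      ↔ ∃ c, a - b = N * c := by
    intro a b
    rw [Submodule.Quotient.eq]
    refine exists_congr fun c => ?_
    rw [← sub_div, eq_div_iff hNK, ← map_sub, Algebra.linearMap_apply, ← map_mul,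
      (IsFractionRing.injective R (FractionRing R)).eq_iff, eq_comm, mul_comm]
  have hex : ∀ (f : FullDual R T) (t : T), ∃ a : R,
      f t = Submodule.Quotient.mk (algebraMap R (FractionRing R) a / algebraMap R _ N) := by
    intro f t
    obtain ⟨q, hq⟩ := Submodule.mkQ_surjective _ (f t)
    have h0 : N • f t = 0 := by rw [← map_nsmul, hNdef, card_nsmul_eq_zero', map_zero]
    rw [← hq, ← map_nsmul, Submodule.mkQ_apply, Submodule.Quotient.mk_eq_zero] at h0
    obtain ⟨a, ha⟩ := h0
    refine ⟨a, ?_⟩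
    rw [← hq, ← Algebra.linearMap_apply, ha, nsmul_eq_mul, map_natCast, mul_div_cancel_left₀]
    · rfl
    · simpa using hNK
  choose a ha using hex
  -- The chosen numerators are additive and `R`-linear only modulo `N R`, which is all that `φ`
  -- modulo `N` sees.
  have hadd : ∀ f t t', ∃ c, a f (t + t') - (a f t + a f t') = N * c := fun f t t' => by
    rw [← hmk, ← ha, map_add, map_add, add_div, Submodule.Quotient.mk_add, ← ha, ← ha]
  have hsmul : ∀ f (r : R) t, ∃ c, a f (r • t) - r * a f t = N * c := fun f r t => by
    rw [← hmk, ← ha, map_smul, map_mul, mul_div_assoc, ← Algebra.smul_def,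
      Submodule.Quotient.mk_smul, ← ha]
  have hφN : ∀ c d e : R, c - d = N * e → ((φ c : ℤ) : ZMod N) = (φ d : ℤ) := by
    intro c d e h
    rw [← sub_eq_zero, ← Int.cast_sub, ← map_sub, h, ← nsmul_eq_mul, map_nsmul]
    simp
  let θ : FullDual R T → AddChar T ℂ := fun f =>
    ZMod.stdAddChar.compAddMonoidHom (AddMonoidHom.mk' (fun t => ((φ (a f t) : ℤ) : ZMod N))
      fun t t' => by
        obtain ⟨c, hc⟩ := hadd f t t'
        rw [hφN _ _ c hc, map_add, Int.cast_add])
  have hθ : Function.Injective θ := by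
    intro f g hfg
    refine LinearMap.ext fun t => ?_
    have h1 : ∀ t, ((φ (a f t) : ℤ) : ZMod N) = (φ (a g t) : ℤ) := fun t =>
      ZMod.injective_stdAddChar (DFunLike.congr_fun hfg t)
    -- Comparing the characters at every `r • t`, not just at `t`, gives the hypothesis of
    -- `exists_eq_mul_of_dvd`.
    have h2 : ∀ r, (N : ℤ) ∣ φ ((a f t - a g t) * r) := fun r => by
      obtain ⟨c, hc⟩ := hsmul f r t
      obtain ⟨c', hc'⟩ := hsmul g r t
      have := h1 (r • t)
      rw [hφN _ _ c hc, hφN _ _ c' hc', ← sub_eq_zero, ← Int.cast_sub, ← map_sub,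
        ZMod.intCast_zmod_eq_zero_iff_dvd] at this
      rwa [sub_mul, mul_comm _ r, mul_comm _ r]
    obtain ⟨s, hs⟩ := hφ.exists_eq_mul_of_dvd (by exact_mod_cast NeZero.ne N) h2
    rw [ha f, ha g, hmk]
    exact ⟨s, by simpa using hs⟩
  have := Fintype.ofFinite T
  exact ⟨Finite.of_injective θ hθ, (Nat.card_le_card_of_injective θ hθ).trans_eq (by
    rw [hNdef, Nat.card_eq_fintype_card, Nat.card_eq_fintype_card, AddChar.card_eq])⟩

namespace IsFrobeniusForm

variable {R : Type} [CommRing R] [IsDomain R] [CharZero R] {φ : R →ₗ[ℤ] ℤ}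

/-- A torsion class `[u]` with `k u = A x` is sent to the functional `⟨x, ·⟩ / k` modulo `R`. The
choices of `u`, `k`, `x` are arbitrary, because only injectivity is needed. -/
lemma card_torsion_coker_le [Module.Finite ℤ R] (hφ : IsFrobeniusForm φ) {ι κ : Type} [Fintype ι]
    [Fintype κ] (A : Matrix ι κ R)
    [Finite (FullDual R (Submodule.torsion R (A.transpose.Coker R)))] :
    Nat.card (Submodule.torsion R (A.Coker R)) ≤
      Nat.card (FullDual R (Submodule.torsion R (A.transpose.Coker R))) := by
  have hex : ∀ t : Submodule.torsion R (A.Coker R), ∃ (u : ι → R) (k : R) (x : κ → R),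
      t.1 = Submodule.Quotient.mk u ∧ k ≠ 0 ∧ k • u = A.actOn R x := by
    rintro ⟨t, k, hk⟩
    obtain ⟨u, rfl⟩ := Submodule.mkQ_surjective _ t
    obtain ⟨x, hx⟩ := (Submodule.Quotient.mk_eq_zero _).mp hk
    exact ⟨u, k, x, rfl, nonZeroDivisors.ne_zero k.2, hx.symm⟩
  choose u k x hu hk hx using hex
  refine Nat.card_le_card_of_injective
    (fun t => (A.cokerDual (hk t) (hx t)).comp (Submodule.subtype _)) fun t t' htt' => ?_
  refine Subtype.ext ?_
  rw [hu t, hu t', Submodule.Quotient.eq]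
  -- The difference of the two representatives, written over the common denominator `k t * k t'`.
  refine hφ.mem_range_of_mul_dvd_pairing A (k := k t * k t') (x := k t' • x t - k t • x t')
    (mul_ne_zero (hk t) (hk t')) ?_ fun v hv => ?_
  · rw [map_sub, map_smul, map_smul, ← hx, ← hx, smul_smul, smul_smul, smul_sub, mul_comm (k t')]
  · have h1 := LinearMap.congr_fun htt' ⟨_, hv⟩
    have hkt : algebraMap R (FractionRing R) (k t) ≠ 0 := by simpa using hk t
    have hkt' : algebraMap R (FractionRing R) (k t') ≠ 0 := by simpa using hk t'
    simp only [LinearMap.comp_apply, Submodule.subtype_apply, Matrix.cokerDual_mk,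
      Submodule.Quotient.eq] at h1
    obtain ⟨r, hr⟩ := h1
    refine ⟨r, IsFractionRing.injective R (FractionRing R) ?_⟩
    have h2 : ∑ j, (k t' • x t - k t • x t') j * v j
        = k t' * (∑ j, x t j * v j) - k t * ∑ j, x t' j * v j := by
      rw [Finset.mul_sum, Finset.mul_sum, ← Finset.sum_sub_distrib]
      refine Finset.sum_congr rfl fun j _ => ?_
      simp only [Pi.sub_apply, Pi.smul_apply, smul_eq_mul]
      ring
    rw [Algebra.linearMap_apply] at hr
    rw [h2, map_sub, map_mul, map_mul, map_mul, map_mul, hr]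
    field_simp

/-- Over a Frobenius order, the torsion of the cokernel of a matrix, the torsion of the cokernel of
its transpose and the full dual of either have the same cardinality. -/
lemma card_torsion_coker_transpose [Module.Finite ℤ R] (hφ : IsFrobeniusForm φ) {ι κ : Type}
    [Fintype ι] [Fintype κ] (A : Matrix ι κ R) :
    Nat.card (Submodule.torsion R (A.transpose.Coker R))
        = Nat.card (Submodule.torsion R (A.Coker R)) ∧
      Nat.card (FullDual R (Submodule.torsion R (A.transpose.Coker R)))
        = Nat.card (Submodule.torsion R (A.transpose.Coker R)) := by
  -- Torsion for `A` ≤ dual for `Aᵀ` ≤ torsion for `Aᵀ`; the same chain for `Aᵀ` closes the cycle.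
  have key : ∀ {ι κ : Type} [Fintype ι] [Fintype κ] (A : Matrix ι κ R),
      Nat.card (Submodule.torsion R (A.Coker R))
        ≤ Nat.card (FullDual R (Submodule.torsion R (A.transpose.Coker R))) ∧
      Nat.card (FullDual R (Submodule.torsion R (A.transpose.Coker R)))
        ≤ Nat.card (Submodule.torsion R (A.transpose.Coker R)) := by
    intro ι κ _ _ A
    have := finite_torsion_of_finite_int (R := R) (A.transpose.Coker R)
    obtain ⟨_, h⟩ := hφ.card_fullDual_le (Submodule.torsion R (A.transpose.Coker R))
    exact ⟨hφ.card_torsion_coker_le A, h⟩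
  have h1 := key A
  have h2 := key A.transpose
  rw [Matrix.transpose_transpose] at h2
  omega

end IsFrobeniusForm

/-! ### Ranks and lattices -/

/-- The dimension of the space of homomorphisms into a field is the rank. -/
lemma finrank_linearMap_field {R F : Type} [CommRing R] [IsDomain R] [Field F] [Algebra R F]
    [FaithfulSMul R F] (X : Type) [AddCommGroup X] [Module R X] [Module.Finite R X] :
    Module.finrank F (X →ₗ[R] F) = Module.finrank R X := by
  rw [(LinearMap.liftBaseChangeEquiv F (M := X) (N := F)).finrank_eq,
    ← (TensorProduct.isBaseChange R X F).finrank_eq]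
  exact Subspace.dual_finrank_eq

lemma finrank_fractionRing_tensorProduct {R : Type} [CommRing R] [IsDomain R] (X : Type)
    [AddCommGroup X] [Module R X] :
    Module.finrank (FractionRing R) (TensorProduct R (FractionRing R) X) = Module.finrank R X :=
  (TensorProduct.isBaseChange R X (FractionRing R)).finrank_eq

lemma Matrix.range_actOn_transpose {R : Type} [CommRing R] {ι κ : Type} [Fintype ι]
    (A : Matrix ι κ R) :
    LinearMap.range (A.transpose.actOn R) = Submodule.span R (Set.range fun i j => A i j) := by
  rw [← Fintype.range_linearCombination]
  congr 1
  refine LinearMap.ext fun y => funext fun j => ?_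
  simp [Matrix.actOn_apply, Fintype.linearCombination_apply, Finset.sum_apply, mul_comm]

/-! ### The lattice as a module over its multipliers -/

namespace EllipticEnd

variable {Λ : Submodule ℤ ℂ} [DiscreteTopology Λ]

noncomputable instance : Algebra (EllipticEnd Λ) ℂ := (multiplierHom Λ).toAlgebra

lemma smul_def (f : EllipticEnd Λ) (z : ℂ) : f • z = multiplier f * z := rfl

instance : FaithfulSMul (EllipticEnd Λ) ℂ :=
  (faithfulSMul_iff_algebraMap_injective _ _).mpr multiplierHom_injective

instance : CharZero (EllipticEnd Λ) :=
  ⟨fun m n h => by simpa using congrArg (algebraMap (EllipticEnd Λ) ℂ) h⟩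

lemma multiplier_mul_mem (f : EllipticEnd Λ) {x : ℂ} (hx : x ∈ Λ) : multiplier f * x ∈ Λ := by
  have h1 : EllipticTorus.proj Λ x = 0 := (Submodule.Quotient.mk_eq_zero Λ).mpr hx
  have h2 := multiplier_spec f x
  rw [h1, map_zero] at h2
  exact (Submodule.Quotient.mk_eq_zero Λ).mp h2.symm

variable (Λ) in
/-- The lattice as a module over its ring of multipliers. -/
def latticeModule : Submodule (EllipticEnd Λ) ℂ where
  carrier := Λ
  zero_mem' := Λ.zero_mem
  add_mem' := Λ.add_mem
  smul_mem' f _ hx := multiplier_mul_mem f hx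

end EllipticEnd

/-! ### Tangent spaces and ranks -/

namespace EllipticArrangement

variable {Λ : Submodule ℤ ℂ} [DiscreteTopology Λ] {d n : ℕ}

/-- The matrix of coefficients of the homomorphisms in `S`. -/
noncomputable def coeffMatrix (l : EllipticArrangement Λ d n) (S : Finset (Fin n)) :
    Matrix S (Fin d) (EllipticEnd Λ) :=
  fun i j => (l i).coeff j

lemma apply_projPi (l : EllipticArrangement Λ d n) (i : Fin n) (z : Fin d → ℂ) :
    (l i).1 (EllipticTorus.projPi Λ d z) = EllipticTorus.proj Λ (∑ j, (l i).coeff j • z j) := by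
  rw [EllipticHom.apply_eq_sum, map_sum]
  exact Finset.sum_congr rfl fun j _ => EllipticEnd.multiplier_spec _ _

lemma projPi_mem_inter (l : EllipticArrangement Λ d n) (S : Finset (Fin n)) (z : Fin d → ℂ) :
    EllipticTorus.projPi Λ d z ∈ l.inter S ↔ ∀ i, (l.coeffMatrix S).actOn ℂ z i ∈ Λ := by
  simp only [inter, AddSubgroup.mem_iInf, AddMonoidHom.mem_ker, apply_projPi,
    Matrix.actOn_apply, Subtype.forall]
  exact forall_congr' fun i => forall_congr' fun _ => Submodule.Quotient.mk_eq_zero Λ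

/-- If all complex multiples of a coordinate of `A v` lie in the discrete group `Λ`, that coordinate
vanishes. -/
lemma mem_tangentSpace (l : EllipticArrangement Λ d n) (S : Finset (Fin n)) (v : Fin d → ℂ) :
    v ∈ tangentSpace (l.inter S) ↔ (l.coeffMatrix S).actOn ℂ v = 0 := by
  have hs : ∀ t : ℂ, (l.coeffMatrix S).actOn ℂ (t • v) = t • (l.coeffMatrix S).actOn ℂ v := by
    intro t
    ext i
    simp [Matrix.actOn_apply, Finset.mul_sum]
  change (∀ t : ℂ, EllipticTorus.projPi Λ d (t • v) ∈ l.inter S) ↔ _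
  simp only [projPi_mem_inter, hs]
  refine ⟨fun h => funext fun i => ?_, fun h t i => by simp [h]⟩
  exact EllipticEnd.eq_zero_of_forall_mul_mem fun t => by
    rw [mul_comm]; exact h t i

/-- The rows of the coefficient matrix span the relations of the realized matroid. -/
lemma range_actOn_transpose (l : EllipticArrangement Λ d n) (S : Finset (Fin n)) :
    LinearMap.range ((l.coeffMatrix S).transpose.actOn (EllipticEnd Λ))
      = Submodule.span (EllipticEnd Λ) ((fun i j => (l i).coeff j) '' (S : Set (Fin n))) := by
  rw [Matrix.range_actOn_transpose, Set.image_eq_range]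
  rfl

/-- The module `M(S)` as the cokernel of the transposed coefficient matrix. -/
noncomputable def matroidObjEquiv (l : EllipticArrangement Λ d n) (S : Finset (Fin n)) :
    l.matroid.obj S ≃ₗ[EllipticEnd Λ] (l.coeffMatrix S).transpose.Coker (EllipticEnd Λ) :=
  Submodule.quotEquivOfEq _ _ (l.range_actOn_transpose S).symm

/-- A homomorphism from the cokernel of `Aᵀ` to `ℂ` is a vector of `ℂ^d` orthogonal to the rows of
`A`, that is, an element of `ker A`; the dimension of this space of homomorphisms is the rank of
`M(S)`. -/
lemma finrank_tangentSpace (l : EllipticArrangement Λ d n) (S : Finset (Fin n)) :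
    Module.finrank ℂ (tangentSpace (l.inter S))
      = Module.finrank (EllipticEnd Λ) (l.matroid.obj S) := by
  rw [(l.matroidObjEquiv S).finrank_eq, ← finrank_linearMap_field (R := EllipticEnd Λ) (F := ℂ)]
  let A := l.coeffMatrix S
  let F : (A.transpose.Coker (EllipticEnd Λ) →ₗ[EllipticEnd Λ] ℂ) →ₗ[ℂ] (Fin d → ℂ) :=
    { toFun := fun h j => h (Submodule.Quotient.mk (Pi.single j 1))
      map_add' := fun _ _ => rfl
      map_smul' := fun _ _ => rfl }
  have hF : Function.Injective F := by
    intro f g hfg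
    refine Submodule.linearMap_qext _ (LinearMap.pi_ext' fun j => LinearMap.ext_ring ?_)
    exact congrFun hfg j
  have hrange : LinearMap.range F = tangentSpace (l.inter S) := by
    ext v
    rw [mem_tangentSpace]
    constructor
    · rintro ⟨h, rfl⟩
      ext i
      have h0 : h (Submodule.Quotient.mk (A.transpose.actOn (EllipticEnd Λ) (Pi.single i 1))) = 0 := by
        rw [(Submodule.Quotient.mk_eq_zero _).mpr (LinearMap.mem_range_self _ _), map_zero]
      have h1 : A.transpose.actOn (EllipticEnd Λ) (Pi.single i 1)
          = ∑ j, A i j • Pi.single j (1 : EllipticEnd Λ) := by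
        ext j
        simp [Matrix.actOn_apply, Pi.single_apply]
      rw [h1, ← Submodule.mkQ_apply, map_sum, map_sum] at h0
      rw [Matrix.actOn_apply, Pi.zero_apply, ← h0]
      exact Finset.sum_congr rfl fun j _ => by rw [map_smul, map_smul]; rfl
    · intro hv
      refine ⟨Submodule.liftQ _ (Fintype.linearCombination (EllipticEnd Λ) v) ?_, ?_⟩
      · rintro _ ⟨y, rfl⟩
        have h2 : Fintype.linearCombination (EllipticEnd Λ) v
            (A.transpose.actOn (EllipticEnd Λ) y) = ∑ i, y i • A.actOn ℂ v i := by
          simp only [Fintype.linearCombination_apply, Matrix.actOn_apply, Matrix.transpose_apply,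
            Finset.smul_sum, Finset.sum_smul, smul_smul, smul_eq_mul]
          rw [Finset.sum_comm]
          exact Finset.sum_congr rfl fun i _ => Finset.sum_congr rfl fun j _ => by
            rw [mul_comm]
        rw [LinearMap.mem_ker, h2, hv]
        simp
      · ext j
        change Fintype.linearCombination (EllipticEnd Λ) v (Pi.single j 1) = v j
        simp
  rw [← hrange]
  exact (LinearEquiv.ofInjective F hF).finrank_eq.symm

lemma rank_eq_matroid_rank (l : EllipticArrangement Λ d n) (S : Finset (Fin n)) :
    l.rank S = l.matroid.rank S := by
  have h0 : Module.finrank (EllipticEnd Λ) (l.matroid.obj ∅) = d := by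
    rw [← finrank_tangentSpace]
    have : tangentSpace (l.inter ∅) = ⊤ := eq_top_iff.mpr fun v _ t => by simp [inter]
    rw [this, finrank_top, Module.finrank_fin_fun]
  rw [rank, ModuleMatroid.rank, finrank_fractionRing_tensorProduct,
    finrank_fractionRing_tensorProduct, h0, finrank_tangentSpace]

end EllipticArrangement

/-! ### Connected components -/

namespace EllipticTorus

lemma projPi_surjective (Λ : Submodule ℤ ℂ) (d : ℕ) : Function.Surjective (projPi Λ d) := by
  intro p
  choose z hz using fun j => Submodule.mkQ_surjective Λ (p j)
  exact ⟨z, funext hz⟩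

lemma projPi_eq_iff {Λ : Submodule ℤ ℂ} {d : ℕ} {z z' : Fin d → ℂ} :
    projPi Λ d z = projPi Λ d z' ↔ ∀ j, z j - z' j ∈ Λ :=
  funext_iff.trans (forall_congr' fun _ => EllipticEnd.proj_eq_iff)

lemma continuous_projPi (Λ : Submodule ℤ ℂ) (d : ℕ) : Continuous (projPi Λ d) :=
  continuous_pi fun j => continuous_quot_mk.comp (continuous_apply j)

lemma isOpenMap_projPi (Λ : Submodule ℤ ℂ) (d : ℕ) : IsOpenMap (projPi Λ d) :=
  IsOpenMap.piMap (f := fun _ : Fin d => Λ.mkQ) (fun _ => Submodule.isOpenMap_mkQ Λ)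
    (Filter.Eventually.of_forall fun _ => Submodule.mkQ_surjective Λ)

end EllipticTorus

/-- A `Q(R)`-linear retraction `ρ : F → Q(R)` carries a solution over `F` to one over `Q(R)`; then
denominators are cleared. -/
lemma Matrix.exists_smul_eq_of_mem_range_field {R F : Type} [CommRing R] [IsDomain R] [Field F]
    [Algebra R F] [FaithfulSMul R F] {ι κ : Type} [Fintype κ] (A : Matrix ι κ R) {z : κ → F}
    {u : ι → R} (h : ∀ i, A.actOn F z i = algebraMap R F (u i)) :
    ∃ r : R, r ≠ 0 ∧ ∃ x : κ → R, A.actOn R x = r • u := by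
  let := FractionRing.liftAlgebra R F
  have : IsScalarTower R (FractionRing R) F := FractionRing.isScalarTower_liftAlgebra R F
  obtain ⟨ρ, hρ⟩ := LinearMap.exists_leftInverse_of_injective
    (Algebra.linearMap (FractionRing R) F)
    (LinearMap.ker_eq_bot.mpr (algebraMap (FractionRing R) F).injective)
  obtain ⟨b, hb⟩ := IsLocalization.exist_integer_multiples (nonZeroDivisors R) Finset.univ
    fun j => ρ (z j)
  choose x hx using fun j => hb j (Finset.mem_univ j)
  refine ⟨b, nonZeroDivisors.ne_zero b.2, x, funext fun i =>
    IsFractionRing.injective R (FractionRing R) ?_⟩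
  have h1 : ρ (A.actOn F z i) = algebraMap R (FractionRing R) (u i) := by
    rw [h, IsScalarTower.algebraMap_apply R (FractionRing R) F]
    exact LinearMap.congr_fun hρ _
  rw [Pi.smul_apply, smul_eq_mul, map_mul, ← h1, Matrix.actOn_apply, Matrix.actOn_apply, map_sum,
    map_sum, Finset.mul_sum]
  refine Finset.sum_congr rfl fun j _ => ?_
  have h2 : ρ (A i j • z j) = A i j • ρ (z j) := (ρ.restrictScalars R).map_smul _ _
  rw [h2, smul_eq_mul, map_mul, hx, Algebra.smul_def, Algebra.smul_def (A i j)]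
  ring

/-! ### Components of an intersection as torsion classes -/

namespace EllipticArrangement

variable {Λ : Submodule ℤ ℂ} [DiscreteTopology Λ] {d n : ℕ}

open EllipticEnd EllipticTorus

/-- The class of `A z ∈ Λ^S` modulo `A Λ^d`. -/
noncomputable def cokerClass {ι : Type} (A : Matrix ι (Fin d) (EllipticEnd Λ)) (z : Fin d → ℂ)
    (hz : ∀ i, A.actOn ℂ z i ∈ Λ) : A.Coker (latticeModule Λ) :=
  Submodule.Quotient.mk fun i => ⟨A.actOn ℂ z i, hz i⟩

lemma cokerClass_eq_iff {ι : Type} (A : Matrix ι (Fin d) (EllipticEnd Λ)) {z z' : Fin d → ℂ}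
    (hz : ∀ i, A.actOn ℂ z i ∈ Λ) (hz' : ∀ i, A.actOn ℂ z' i ∈ Λ) :
    cokerClass A z hz = cokerClass A z' hz' ↔
      ∃ x : Fin d → ℂ, (∀ j, x j ∈ Λ) ∧ A.actOn ℂ (z - z' - x) = 0 := by
  rw [cokerClass, cokerClass, Submodule.Quotient.eq]
  constructor
  · rintro ⟨x, hx⟩
    refine ⟨fun j => x j, fun j => (x j).2, funext fun i => ?_⟩
    have h1 := congrArg Subtype.val (congrFun hx i)
    have h2 : A.actOn ℂ (fun j => (x j : ℂ)) i = A.actOn ℂ z i - A.actOn ℂ z' i := by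
      refine Eq.trans ?_ h1
      rw [Matrix.actOn_apply, Matrix.actOn_apply]
      simp
    rw [map_sub, map_sub, Pi.sub_apply, Pi.sub_apply, h2, sub_self, Pi.zero_apply]
  · rintro ⟨x, hx, h⟩
    refine ⟨fun j => ⟨x j, hx j⟩, funext fun i => Subtype.ext ?_⟩
    have h1 := congrFun h i
    rw [map_sub, map_sub, Pi.sub_apply, Pi.sub_apply, Pi.zero_apply, sub_eq_zero] at h1
    rw [Pi.sub_apply, AddSubgroupClass.coe_sub, h1, Matrix.actOn_apply, Matrix.actOn_apply]
    simp

/-- Since `r Λ ⊆ R`, the vector `r A z` has entries in `R`, so the system with this right-hand side,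
solvable over `ℂ`, is solvable over `R` after a further multiple `s`. As `1 ∈ Λ`, the solution lies
in `Λ^d`, and `s * r` kills the class. -/
lemma cokerClass_mem_torsion {ι : Type} (A : Matrix ι (Fin d) (EllipticEnd Λ)) (z : Fin d → ℂ)
    (hz : ∀ i, A.actOn ℂ z i ∈ Λ) (h1 : (1 : ℂ) ∈ Λ) {r : EllipticEnd Λ} (hr : r ≠ 0)
    (hrΛ : ∀ x ∈ Λ, ∃ b : EllipticEnd Λ, r • x = algebraMap (EllipticEnd Λ) ℂ b) :
    cokerClass A z hz ∈ Submodule.torsion (EllipticEnd Λ) (A.Coker (latticeModule Λ)) := by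
  choose u hu using fun i => hrΛ _ (hz i)
  obtain ⟨s, hs, x, hx⟩ := A.exists_smul_eq_of_mem_range_field (z := r • z) (u := u)
    (fun i => by rw [map_smul, Pi.smul_apply, hu])
  refine ⟨⟨s * r, mem_nonZeroDivisors_of_ne_zero (mul_ne_zero hs hr)⟩, ?_⟩
  change (s * r) • Submodule.Quotient.mk _ = (0 : A.Coker (latticeModule Λ))
  rw [← Submodule.Quotient.mk_smul, Submodule.Quotient.mk_eq_zero]
  refine ⟨fun j => ⟨algebraMap (EllipticEnd Λ) ℂ (x j), ?_⟩, funext fun i => Subtype.ext ?_⟩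
  · rw [← mul_one (algebraMap _ _ _)]
    exact multiplier_mul_mem (x j) h1
  · have h2 := congrArg (algebraMap (EllipticEnd Λ) ℂ) (congrFun hx i)
    rw [Pi.smul_apply, smul_eq_mul, map_mul, ← hu, ← Algebra.smul_def, smul_smul] at h2
    change _ = (s * r) • A.actOn ℂ z i
    rw [← h2, Matrix.actOn_apply, Matrix.actOn_apply]
    simp [Algebra.smul_def]

/-- The class map on the intersection is locally constant with connected fibres and is onto the
torsion, so it induces a bijection from the components. -/
lemma mult_eq_card_torsion (l : EllipticArrangement Λ d n) (S : Finset (Fin n)) (h1 : (1 : ℂ) ∈ Λ)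
    {r : EllipticEnd Λ} (hr : r ≠ 0)
    (hrΛ : ∀ x ∈ Λ, ∃ b : EllipticEnd Λ, r • x = algebraMap (EllipticEnd Λ) ℂ b) :
    l.mult S = Nat.card (Submodule.torsion (EllipticEnd Λ)
      ((l.coeffMatrix S).Coker (latticeModule Λ))) := by
  set A := l.coeffMatrix S with hA
  choose z hz using fun p : l.inter S => projPi_surjective Λ d p.1
  have hzΛ : ∀ p, ∀ i, A.actOn ℂ (z p) i ∈ Λ := fun p =>
    (l.projPi_mem_inter S _).mp (by rw [hz]; exact p.2)
  let c : l.inter S → Submodule.torsion (EllipticEnd Λ) (A.Coker (latticeModule Λ)) := fun p =>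
    ⟨cokerClass A (z p) (hzΛ p), cokerClass_mem_torsion A _ _ h1 hr hrΛ⟩
  -- Any lift computes the class, since two lifts differ by a vector of `Λ^d`.
  have hc : ∀ (y : Fin d → ℂ) (hy : projPi Λ d y ∈ l.inter S),
      (c ⟨_, hy⟩).1 = cokerClass A y ((l.projPi_mem_inter S y).mp hy) := by
    intro y hy
    refine (cokerClass_eq_iff A _ _).mpr ⟨z ⟨_, hy⟩ - y, projPi_eq_iff.mp (hz ⟨_, hy⟩), ?_⟩
    rw [sub_self, map_zero]
  have hloc : IsLocallyConstant c := by
    rw [IsLocallyConstant.iff_eventually_eq]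
    intro p
    obtain ⟨ε, hε, hΛ⟩ := exists_isolated (Λ := Λ)
    have hcont : Continuous (A.actOn ℂ) := by
      refine continuous_pi fun i => ?_
      simp only [Matrix.actOn_apply, smul_def]
      fun_prop
    -- For nearby lifts, the entries of the difference of `A`-values are lattice elements shorter
    -- than `ε`, hence zero. Openness of the projection transfers this to a neighbourhood of `p`.
    have hnear : ∀ᶠ y in 𝓝 (z p), ∀ i, ‖A.actOn ℂ y i - A.actOn ℂ (z p) i‖ < ε := by
      rw [Filter.eventually_all]
      intro i
      have : ContinuousAt (fun y => ‖A.actOn ℂ y i - A.actOn ℂ (z p) i‖) (z p) :=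
        ((((continuous_apply i).comp hcont).sub continuous_const).norm).continuousAt
      refine this.eventually_lt_const ?_
      simpa using hε
    have himg := (isOpenMap_projPi Λ d).image_mem_nhds hnear
    rw [hz p] at himg
    filter_upwards [continuous_subtype_val.continuousAt.preimage_mem_nhds himg] with q hq
    obtain ⟨y, hy, hyq⟩ := hq
    obtain ⟨q, hqS⟩ := q
    obtain rfl : projPi Λ d y = q := hyq
    refine Subtype.ext ?_
    rw [hc y hqS]
    refine (cokerClass_eq_iff A _ _).mpr ⟨0, fun _ => Λ.zero_mem, funext fun i => ?_⟩
    rw [sub_zero, map_sub]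
    exact hΛ _ (Λ.sub_mem ((l.projPi_mem_inter S y).mp hqS i) (hzΛ p i)) (hy i)
  have hconn : ∀ p q, c p = c q → (p : ConnectedComponents (l.inter S)) = q := by
    intro p q hpq
    obtain ⟨x, hx, h0⟩ := (cokerClass_eq_iff A (hzΛ p) (hzΛ q)).mp (congrArg Subtype.val hpq)
    -- The segment runs in a direction of `ker A` and ends at `z p - x`, again a lift of `p` because
    -- `x ∈ Λ^d`.
    have hmem : ∀ t : ℝ, projPi Λ d (z q + t • (z p - z q - x)) ∈ l.inter S := by
      intro t
      rw [map_add, hz]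
      refine (l.inter S).add_mem q.2 ?_
      have := (l.mem_tangentSpace S _).mpr h0 (t : ℂ)
      rwa [Complex.coe_smul] at this
    let γ : ℝ → l.inter S := fun t => ⟨_, hmem t⟩
    have hγ : Continuous γ :=
      ((continuous_projPi Λ d).comp (by fun_prop)).subtype_mk _
    have h0' : γ 0 = q := Subtype.ext (by simp [γ, hz])
    have h1' : γ 1 = p := Subtype.ext (by
      rw [← hz p]
      refine projPi_eq_iff.mpr fun j => ?_
      have : (z q + (1 : ℝ) • (z p - z q - x)) j - z p j = - x j := by
        simp only [one_smul, Pi.add_apply, Pi.sub_apply]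
        ring
      rw [this]
      exact Λ.neg_mem (hx j))
    rw [ConnectedComponents.coe_eq_coe']
    exact (isPreconnected_range hγ).subset_connectedComponent ⟨0, h0'⟩ ⟨1, h1'⟩
  let F : ConnectedComponents (l.inter S) →
      Submodule.torsion (EllipticEnd Λ) (A.Coker (latticeModule Λ)) :=
    Quotient.lift c fun p q (hpq : connectedComponent p = connectedComponent q) =>
      hloc.apply_eq_of_isPreconnected isPreconnected_connectedComponent
        (mem_connectedComponent (x := p)) (hpq ▸ mem_connectedComponent)
  refine Nat.card_congr (Equiv.ofBijective F ⟨?_, ?_⟩)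
  · rintro ⟨p⟩ ⟨q⟩ h
    exact hconn p q h
  · rintro ⟨t, s, hs⟩
    obtain ⟨u, rfl⟩ := Submodule.mkQ_surjective _ t
    obtain ⟨x, hx⟩ := (Submodule.Quotient.mk_eq_zero _).mp hs
    have hs0 : multiplier s.1 ≠ 0 := fun h => nonZeroDivisors.ne_zero s.2
      (multiplierHom_injective (h.trans (map_zero (multiplierHom Λ)).symm))
    -- From `s u = A x` with `x ∈ Λ^d`, dividing by `s` in `ℂ` gives a lift `y` with `A y = u`.
    let y : Fin d → ℂ := fun j => (multiplier s.1)⁻¹ * (x j : ℂ)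
    have hy : ∀ i, A.actOn ℂ y i = u i := by
      intro i
      have h2 : (A.actOn (latticeModule Λ) x i : ℂ) = multiplier s.1 * u i :=
        congrArg Subtype.val (congrFun hx i)
      rw [Matrix.actOn_apply] at h2
      rw [Matrix.actOn_apply, ← mul_right_inj' hs0, ← h2, Finset.mul_sum]
      simp only [AddSubmonoidClass.coe_finsetSum, Submodule.coe_smul, smul_def, y]
      exact Finset.sum_congr rfl fun j _ => by field_simp
    have hyS : projPi Λ d y ∈ l.inter S :=
      (l.projPi_mem_inter S y).mpr fun i => by rw [← hA, hy]; exact (u i).2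
    refine ⟨((⟨_, hyS⟩ : l.inter S) : ConnectedComponents (l.inter S)), Subtype.ext ?_⟩
    refine (hc y hyS).trans ?_
    change Submodule.Quotient.mk _ = Submodule.Quotient.mk _
    congr 1
    exact funext fun i => Subtype.ext (hy i)

end EllipticArrangement

/-! ### Quadratic orders -/

/-- In a quadratic ring `ℤ[θ]` the coefficient of `θ` is a Frobenius form. -/
lemma exists_isFrobeniusForm_of_quadratic {R : Type} [CommRing R] (θ : R) (m k : ℤ)
    (hθ : θ * θ = m * θ + k) (hspan : ∀ f : R, ∃ s t : ℤ, f = s + t * θ)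
    (hind : ∀ s t : ℤ, (s + t * θ : R) = 0 → s = 0 ∧ t = 0) :
    ∃ φ : R →ₗ[ℤ] ℤ, IsFrobeniusForm φ := by
  have huniq : ∀ s t s' t' : ℤ, (s + t * θ : R) = s' + t' * θ → t = t' := by
    intro s t s' t' h
    have := (hind (s - s') (t - t') (by push_cast; linear_combination h)).2
    omega
  choose s t hst using hspan
  let φ : R →ₗ[ℤ] ℤ := AddMonoidHom.toIntLinearMap
    { toFun := t
      map_zero' := huniq _ _ 0 0 (by rw [← hst]; simp)
      map_add' := fun f g => huniq _ _ (s f + s g) _ (by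
        rw [← hst]; push_cast; linear_combination hst f + hst g) }
  have hφ : ∀ s t : ℤ, φ (s + t * θ) = t := fun s' t' => huniq _ _ s' _ (hst _).symm
  -- For `s = s₀ + s₁ θ` one has `φ(s) = s₁` and `φ(s θ) = s₀ + m s₁`; these must equal `ψ 1` and `ψ
  -- θ`.
  refine ⟨φ, fun ψ => ⟨((ψ θ - m * ψ 1 : ℤ) : R) + (ψ 1 : ℤ) * θ, fun r => ?_⟩, fun f hf => ?_⟩
  · have h1 : ψ r = s r * ψ 1 + t r * ψ θ := by
      conv_lhs => rw [hst r]
      rw [map_add, ← zsmul_eq_mul, map_smul, ← zsmul_one, map_smul, smul_eq_mul, smul_eq_mul]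
    have h2 : (((ψ θ - m * ψ 1 : ℤ) : R) + (ψ 1 : ℤ) * θ) * r
        = ((ψ θ - m * ψ 1) * s r + ψ 1 * t r * k : ℤ)
          + (s r * ψ 1 + t r * ψ θ : ℤ) * θ := by
      conv_lhs => rw [hst r]
      push_cast
      linear_combination (ψ 1 * t r : R) * hθ
    rw [h1, h2, hφ]
  · have h1 : t f = 0 := by
      have := hf 1
      rwa [mul_one, hst f, hφ] at this
    have h2 : s f = 0 := by
      have := hf θ
      have h3 : f * θ = ((0 : ℤ) : R) + (s f) * θ := by
        conv_lhs => rw [hst f, h1]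
        push_cast; ring
      rwa [h3, hφ] at this
    rw [hst f, h1, h2]
    simp

lemma finite_int_of_quadratic {R : Type} [CommRing R] (θ : R)
    (hspan : ∀ f : R, ∃ s t : ℤ, f = s + t * θ) : Module.Finite ℤ R := by
  refine Module.Finite.of_surjective (Fintype.linearCombination ℤ ![(1 : R), θ]) fun f => ?_
  obtain ⟨s, t, rfl⟩ := hspan f
  exact ⟨![s, t], by simp [Fintype.linearCombination_apply, Fin.sum_univ_two]⟩

/-- A primitive binary quadratic form represents integers coprime to any given one. -/
lemma exists_isCoprime_quadratic_form {a b c p q r : ℤ} (h : p * a + q * b + r * c = 1) {N : ℕ}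
    (hN : N ≠ 0) : ∃ x y : ℤ, IsCoprime (a * x ^ 2 - b * x * y + c * y ^ 2) (N : ℤ) := by
  classical
  -- Modulo each prime `l ∣ N` exactly one term survives: `a X²` if `l ∤ a`, `c Y²` if `l ∣ a` and
  -- `l ∤ c`, and `b X Y` if `l` divides both, where `l ∤ b` by primitivity.
  let X : ℕ := ∏ l ∈ N.primeFactors.filter fun l : ℕ => (l : ℤ) ∣ a ∧ ¬ (l : ℤ) ∣ c, l
  let Y : ℕ := ∏ l ∈ N.primeFactors.filter fun l : ℕ => ¬ (l : ℤ) ∣ a, l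
  have hdvd : ∀ (s : Finset ℕ) (l : ℕ), (∀ i ∈ s, i.Prime) → l.Prime →
      ((l : ℤ) ∣ ((∏ i ∈ s, i : ℕ) : ℤ) ↔ l ∈ s) := by
    intro s l hs hl
    rw [Int.natCast_dvd_natCast, hl.prime.dvd_finsetProd_iff]
    constructor
    · rintro ⟨i, hi, hli⟩
      rwa [(Nat.prime_dvd_prime_iff_eq hl (hs i hi)).mp hli]
    · exact fun hl => ⟨l, hl, dvd_rfl⟩
  refine ⟨X, Y, ?_⟩
  rw [Int.isCoprime_iff_gcd_eq_one]
  by_contra hne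
  obtain ⟨l, hl, hlg⟩ := Nat.exists_prime_and_dvd hne
  have hlm : (l : ℤ) ∣ a * (X : ℤ) ^ 2 - b * X * Y + c * (Y : ℤ) ^ 2 :=
    (Int.natCast_dvd_natCast.mpr hlg).trans (Int.gcd_dvd_left _ _)
  have hlN : l ∣ N := Int.natCast_dvd_natCast.mp
    ((Int.natCast_dvd_natCast.mpr hlg).trans (Int.gcd_dvd_right _ _))
  have hlN' : l ∈ N.primeFactors := Nat.mem_primeFactors.mpr ⟨hl, hlN, hN⟩
  have hX : (l : ℤ) ∣ X ↔ ((l : ℤ) ∣ a ∧ ¬ (l : ℤ) ∣ c) := by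
    rw [hdvd _ l (fun i hi => Nat.prime_of_mem_primeFactors (Finset.mem_filter.mp hi).1) hl,
      Finset.mem_filter]
    exact and_iff_right hlN'
  have hY : (l : ℤ) ∣ Y ↔ ¬ (l : ℤ) ∣ a := by
    rw [hdvd _ l (fun i hi => Nat.prime_of_mem_primeFactors (Finset.mem_filter.mp hi).1) hl,
      Finset.mem_filter]
    exact and_iff_right hlN'
  have hp : Prime (l : ℤ) := Nat.prime_iff_prime_int.mp hl
  by_cases ha : (l : ℤ) ∣ a
  · by_cases hc : (l : ℤ) ∣ c
    · have hb : (l : ℤ) ∣ b * X * Y := by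
        have h1 : (l : ℤ) ∣ a * (X : ℤ) ^ 2 + c * (Y : ℤ) ^ 2 :=
          dvd_add (ha.mul_right _) (hc.mul_right _)
        have := dvd_sub h1 hlm
        ring_nf at this ⊢
        exact this
      rcases hp.dvd_or_dvd hb with hb | hb
      · rcases hp.dvd_or_dvd hb with hb | hb
        · refine hp.not_dvd_one (h ▸ ?_)
          exact dvd_add (dvd_add (ha.mul_left _) (hb.mul_left _)) (hc.mul_left _)
        · exact (hX.mp hb).2 hc
      · exact hY.mp hb ha
    · have hx := hX.mpr ⟨ha, hc⟩
      have h1 : (l : ℤ) ∣ c * (Y : ℤ) ^ 2 := by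
        have h2 : (l : ℤ) ∣ X * (a * X - b * Y) := hx.mul_right _
        have := dvd_sub hlm h2
        ring_nf at this ⊢
        exact this
      rcases hp.dvd_or_dvd h1 with h1 | h1
      · exact hc h1
      · exact hY.mp (hp.dvd_of_dvd_pow h1) ha
  · have hy := hY.mpr ha
    have h1 : (l : ℤ) ∣ a * (X : ℤ) ^ 2 := by
      have h2 : (l : ℤ) ∣ Y * (c * Y - b * X) := hy.mul_right _
      have := dvd_sub hlm h2
      ring_nf at this ⊢
      exact this
    rcases hp.dvd_or_dvd h1 with h1 | h1
    · exact ha h1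
    · exact ha (hX.mp (hp.dvd_of_dvd_pow h1)).1

/-! ### Primitive integral equations of quadratic numbers -/

section Quadratic

variable {w : ℂ}

lemma eq_zero_of_natDegree_minpoly_eq_two (hw : (minpoly ℚ w).natDegree = 2) (x y : ℤ)
    (h : (x + y * w : ℂ) = 0) : x = 0 ∧ y = 0 := by
  have hy : y = 0 := by
    by_contra hy
    have hy' : (y : ℂ) ≠ 0 := Int.cast_ne_zero.mpr hy
    have : (minpoly ℚ w).natDegree = 1 := minpoly.natDegree_eq_one_iff.mpr
      ⟨-x / y, by
        rw [eq_ratCast]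
        push_cast
        rw [div_eq_iff hy']
        linear_combination -h⟩
    omega
  subst hy
  simpa using h

/-- Denominators of the minimal polynomial are cleared and the gcd divided out; `p`, `q`, `r` are
Bézout coefficients. -/
lemma exists_primitive_quadratic (hw : (minpoly ℚ w).natDegree = 2) :
    ∃ a b c p q r : ℤ, a ≠ 0 ∧ (a * w ^ 2 + b * w + c : ℂ) = 0 ∧ p * a + q * b + r * c = 1 := by
  have hint : IsIntegral ℚ w := by
    -- For a non-integral element `minpoly` is zero by convention, so its degree could not be 2.
    by_contra h
    rw [minpoly.eq_zero h] at hw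
    simp at hw
  have hmonic := minpoly.monic hint
  have h0 := minpoly.aeval ℚ w
  have hlead : (minpoly ℚ w).coeff 2 = 1 := by rw [← hw]; exact hmonic
  rw [Polynomial.aeval_eq_sum_range, hw] at h0
  simp only [Finset.sum_range_succ, Finset.range_zero, Finset.sum_empty, hlead] at h0
  set s := (minpoly ℚ w).coeff 1
  set t := (minpoly ℚ w).coeff 0
  have hs : (s.den : ℂ) ≠ 0 := Nat.cast_ne_zero.mpr s.den_ne_zero
  have ht : (t.den : ℂ) ≠ 0 := Nat.cast_ne_zero.mpr t.den_ne_zero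
  have hs' : (s : ℂ) = s.num / s.den := Rat.cast_def s
  have ht' : (t : ℂ) = t.num / t.den := Rat.cast_def t
  simp only [Rat.smul_def, hs', ht', Rat.cast_one] at h0
  let a : ℤ := s.den * t.den
  let b : ℤ := s.num * t.den
  let c : ℤ := t.num * s.den
  have ha : a ≠ 0 := mul_ne_zero (by exact_mod_cast s.den_ne_zero) (by exact_mod_cast t.den_ne_zero)
  have habc : (a * w ^ 2 + b * w + c : ℂ) = 0 := by
    simp only [a, b, c]
    push_cast
    field_simp at h0
    linear_combination h0
  let g : ℤ := Int.gcd a (Int.gcd b c)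
  have hg : g ≠ 0 := by
    simp only [g, ne_eq, Nat.cast_eq_zero, Int.gcd_eq_zero_iff]
    tauto
  obtain ⟨a', ha'⟩ : g ∣ a := Int.gcd_dvd_left _ _
  obtain ⟨b', hb'⟩ : g ∣ b := (Int.gcd_dvd_right a _).trans (Int.gcd_dvd_left _ _)
  obtain ⟨c', hc'⟩ : g ∣ c := (Int.gcd_dvd_right a _).trans (Int.gcd_dvd_right _ _)
  have hbez : g = a * Int.gcdA a (Int.gcd b c)
      + (b * Int.gcdA b c + c * Int.gcdB b c) * Int.gcdB a (Int.gcd b c) := by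
    rw [← Int.gcd_eq_gcd_ab b c]
    exact Int.gcd_eq_gcd_ab a _
  generalize Int.gcdA a (Int.gcd b c) = u at hbez
  generalize Int.gcdB a (Int.gcd b c) = v at hbez
  generalize Int.gcdA b c = u' at hbez
  generalize Int.gcdB b c = v' at hbez
  refine ⟨a', b', c', u, u' * v, v' * v, ?_, ?_, mul_left_cancel₀ hg ?_⟩
  · rintro rfl
    exact ha (by rw [ha', mul_zero])
  · have hgC : (g : ℂ) ≠ 0 := Int.cast_ne_zero.mpr hg
    rw [← mul_right_inj' hgC, mul_zero, ← habc, ha', hb', hc']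
    push_cast
    ring
  · rw [ha', hb', hc'] at hbez
    linear_combination -hbez

end Quadratic

/-! ### The multiplier ring of `ℤ + ℤ w` -/

namespace EllipticEnd

variable {Λ : Submodule ℤ ℂ}

/-- A complex number preserving the lattice is the multiplier of an isogeny. -/
lemma exists_multiplier_eq [DiscreteTopology Λ] {α : ℂ} (h : ∀ x ∈ Λ, α * x ∈ Λ) :
    ∃ f : EllipticEnd Λ, multiplier f = α := by
  let m : ℂ →ₗ[ℤ] ℂ := (AddMonoidHom.mulLeft α).toIntLinearMap
  let f : AddMonoid.End (EllipticTorus Λ) := (Submodule.mapQ Λ Λ m h).toAddMonoidHom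
  exact ⟨⟨f, fun v => ⟨fun u => α * u, Filter.Eventually.of_forall fun u =>
    ⟨differentiableAt_id.const_mul α, rfl⟩⟩⟩, multiplier_eq fun z => rfl⟩

lemma algebraMap_injective [DiscreteTopology Λ] :
    Function.Injective (algebraMap (EllipticEnd Λ) ℂ) :=
  multiplierHom_injective

/-- For `Λ = ℤ + ℤ w` with `a w² + b w + c = 0` primitive, the ring of multipliers is `ℤ + ℤ a w`. -/
lemma exists_generator [DiscreteTopology Λ] {w : ℂ} (hΛ : Λ = Submodule.span ℤ {1, w})
    (hind : ∀ x y : ℤ, (x + y * w : ℂ) = 0 → x = 0 ∧ y = 0) {a b c p q r : ℤ}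
    (habc : (a * w ^ 2 + b * w + c : ℂ) = 0) (hpqr : p * a + q * b + r * c = 1) :
    ∃ θ : EllipticEnd Λ, algebraMap (EllipticEnd Λ) ℂ θ = a * w ∧
      ∀ f : EllipticEnd Λ, ∃ s t : ℤ, f = s + t * θ := by
  have hmem : ∀ x, x ∈ Λ ↔ ∃ m k : ℤ, (m + k * w : ℂ) = x := by
    intro x
    rw [hΛ, Submodule.mem_span_pair]
    simp [zsmul_eq_mul]
  obtain ⟨θ, hθ⟩ := exists_multiplier_eq (Λ := Λ) (α := a * w) (by
    intro x hx
    obtain ⟨m, k, rfl⟩ := (hmem x).mp hx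
    refine (hmem _).mpr ⟨-k * c, a * m - k * b, ?_⟩
    push_cast
    linear_combination (-k : ℂ) * habc)
  refine ⟨θ, hθ, fun f => ?_⟩
  obtain ⟨x, y, hxy⟩ := (hmem _).mp (multiplier_mul_mem f ((hmem 1).mpr ⟨1, 0, by simp⟩))
  obtain ⟨m, k, hmk⟩ := (hmem _).mp (multiplier_mul_mem f ((hmem w).mpr ⟨0, 1, by simp⟩))
  rw [mul_one] at hxy
  rw [← hxy] at hmk
  obtain ⟨h1, h2⟩ := hind (a * m + y * c) (a * k - a * x + y * b) (by
    push_cast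
    linear_combination (a : ℂ) * hmk + (y : ℂ) * habc)
  -- Comparing coordinates of `(x + y w) w = m + k w` gives `y c = -a m` and `y b = a (x - k)`.
  -- Inserting these in `y = y (p a + q b + r c)` exhibits `y / a` as this integer.
  refine ⟨x, y * p + q * (x - k) - r * m, algebraMap_injective ?_⟩
  have hy : y = a * (y * p + q * (x - k) - r * m) := by
    linear_combination (-y) * hpqr + q * h2 + r * h1
  rw [map_add, map_mul, map_intCast, map_intCast]
  change multiplier f = x + _ * multiplier θ
  rw [hθ, ← hxy]
  conv_lhs => rw [hy]
  push_cast
  ring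

end EllipticEnd

/-- Isomorphic modules have isomorphic torsion submodules. -/
def torsionEquiv {R : Type} [CommRing R] {M N : Type} [AddCommGroup M] [AddCommGroup N]
    [Module R M] [Module R N] (e : M ≃ₗ[R] N) :
    Submodule.torsion R M ≃ₗ[R] Submodule.torsion R N :=
  e.ofSubmodules _ _ (by
    ext y
    rw [Submodule.mem_map]
    constructor
    · rintro ⟨x, ⟨a, ha⟩, rfl⟩
      exact ⟨a, by
        change (a : R) • e x = 0
        rw [← map_smul]
        exact (congrArg e ha).trans (map_zero e)⟩
    · rintro ⟨a, ha⟩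
      refine ⟨e.symm y, ⟨a, ?_⟩, e.apply_symm_apply y⟩
      change (a : R) • e.symm y = 0
      rw [← map_smul]
      exact (congrArg e.symm ha).trans (map_zero e.symm))

lemma card_fullDual_congr {R : Type} [CommRing R] {M N : Type} [AddCommGroup M] [AddCommGroup N]
    [Module R M] [Module R N] (e : M ≃ₗ[R] N) :
    Nat.card (FullDual R M) = Nat.card (FullDual R N) :=
  Nat.card_congr (e.arrowCongr (LinearEquiv.refl R _)).toEquiv

/-! ### Comparison of the lattice with its multiplier ring -/

namespace EllipticEnd

variable {Λ : Submodule ℤ ℂ}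

/-- A lattice admits maps to and from its ring of multipliers, mutually inverse up to an integer
represented by the associated form. -/
lemma exists_latticeModule_maps [DiscreteTopology Λ] {w : ℂ} (hΛ : Λ = Submodule.span ℤ {1, w})
    {a b c : ℤ} (habc : (a * w ^ 2 + b * w + c : ℂ) = 0) {θ : EllipticEnd Λ}
    (hθ : algebraMap (EllipticEnd Λ) ℂ θ = a * w) (x y : ℤ) :
    ∃ (f : EllipticEnd Λ →ₗ[EllipticEnd Λ] latticeModule Λ)
      (g : latticeModule Λ →ₗ[EllipticEnd Λ] EllipticEnd Λ),
      (∀ r, g (f r) = (a * x ^ 2 - b * x * y + c * y ^ 2) • r) ∧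
      ∀ v, f (g v) = (a * x ^ 2 - b * x * y + c * y ^ 2) • v := by
  have hmem : ∀ z, z ∈ Λ ↔ ∃ m k : ℤ, (m + k * w : ℂ) = z := by
    intro z
    rw [hΛ, Submodule.mem_span_pair]
    simp [zsmul_eq_mul]
  set m : ℤ := a * x ^ 2 - b * x * y + c * y ^ 2 with hm
  -- This is `a (x + y w')` for the other root `w'`, as `a w' = -b - a w`; its product with `x + y
  -- w` is `a` times the norm.
  let β : EllipticEnd Λ := (a * x - b * y : ℤ) - y * θ
  have hβ : algebraMap (EllipticEnd Λ) ℂ β = a * x - b * y - y * (a * w) := by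
    simp [β, hθ]
  have hβm : (x + y * w : ℂ) * (a * x - b * y - y * (a * w)) = m := by
    rw [hm]
    push_cast
    linear_combination (-(y : ℂ) ^ 2) * habc
  have hβΛ : ∀ v : latticeModule Λ, (β • v : ℂ) ∈
      LinearMap.range (Algebra.linearMap (EllipticEnd Λ) ℂ) := by
    rintro ⟨v, hv⟩
    obtain ⟨s, t, rfl⟩ := (hmem v).mp hv
    -- By the equation of `w`, `β w = x (a w) + y c`.
    refine ⟨s * β + t * (x * θ + y * c), ?_⟩
    change algebraMap (EllipticEnd Λ) ℂ _ = β • (s + t * w : ℂ)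
    rw [Algebra.smul_def]
    simp only [map_add, map_mul, map_intCast, hβ, hθ]
    linear_combination (t * y : ℂ) * habc
  let e := LinearEquiv.ofInjective (Algebra.linearMap (EllipticEnd Λ) ℂ) algebraMap_injective
  let f : EllipticEnd Λ →ₗ[EllipticEnd Λ] latticeModule Λ :=
    LinearMap.toSpanSingleton _ _ ⟨x + y * w, (hmem _).mpr ⟨x, y, rfl⟩⟩
  let g : latticeModule Λ →ₗ[EllipticEnd Λ] EllipticEnd Λ :=
    e.symm.toLinearMap ∘ₗ
      LinearMap.codRestrict _ (β • (latticeModule Λ).subtype) hβΛ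
  have hg : ∀ v, algebraMap (EllipticEnd Λ) ℂ (g v) = β • (v : ℂ) := fun v =>
    congrArg Subtype.val (e.apply_symm_apply _)
  have hf : ∀ r, (f r : ℂ) = algebraMap (EllipticEnd Λ) ℂ r * (x + y * w) := fun r => rfl
  refine ⟨f, g, fun r => algebraMap_injective ?_, fun v => Subtype.ext ?_⟩
  · rw [hg, Algebra.smul_def, hβ, hf, zsmul_eq_mul, map_mul, map_intCast, ← hβm]
    ring
  · rw [hf, hg, Algebra.smul_def, hβ, Submodule.coe_smul_of_tower, zsmul_eq_mul, ← hβm]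
    ring

end EllipticEnd

open EllipticEnd in
/-- The multiplicities and the full duals are both counted by the torsion of the matroid. -/
lemma EllipticArrangement.card_torsion_of_quadratic (w : ℂ) (hw : (minpoly ℚ w).natDegree = 2)
    (Λ : Submodule ℤ ℂ) [DiscreteTopology Λ] [IsZLattice ℝ Λ]
    (hΛ : Λ = Submodule.span ℤ {1, w}) (d n : ℕ) (l : EllipticArrangement Λ d n)
    (S : Finset (Fin n)) :
    Finite (l.matroid.tor S) ∧ l.mult S = Nat.card (l.matroid.tor S) ∧
      Nat.card (FullDual (EllipticEnd Λ) (l.matroid.tor S)) = Nat.card (l.matroid.tor S) := by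
  have hind := eq_zero_of_natDegree_minpoly_eq_two hw
  obtain ⟨a, b, c, p, q, r, ha, habc, hpqr⟩ := exists_primitive_quadratic hw
  obtain ⟨θ, hθ, hspan⟩ := exists_generator hΛ hind habc hpqr
  have haC : (a : ℂ) ≠ 0 := Int.cast_ne_zero.mpr ha
  -- Multiplying the equation of `w` by `a` gives `(a w)² = -b (a w) - a c`.
  obtain ⟨φ, hφ⟩ := exists_isFrobeniusForm_of_quadratic θ (-b) (-(a * c))
    (algebraMap_injective (by
      simp only [map_mul, map_add, map_intCast, hθ]
      push_cast
      linear_combination (a : ℂ) * habc))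
    hspan (fun s t h => by
      have h1 := congrArg (algebraMap (EllipticEnd Λ) ℂ) h
      simp only [map_mul, map_add, map_intCast, hθ, map_zero] at h1
      obtain ⟨h2, h3⟩ := hind s (t * a) (by push_cast; linear_combination h1)
      exact ⟨h2, (mul_eq_zero.mp h3).resolve_right ha⟩)
  have hfin : Module.Finite ℤ (EllipticEnd Λ) := finite_int_of_quadratic θ hspan
  have : Module.Finite ℤ Λ := ZLattice.module_finite ℝ Λ
  have : Module.Finite ℤ (latticeModule Λ) := ‹Module.Finite ℤ Λ›
  have : Module.Finite (EllipticEnd Λ) (latticeModule Λ) :=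
    Module.Finite.of_restrictScalars_finite ℤ _ _
  set A := l.coeffMatrix S
  have hA1 : Finite (Submodule.torsion (EllipticEnd Λ) (A.Coker (EllipticEnd Λ))) :=
    finite_torsion_of_finite_int _
  have hA2 : Finite (Submodule.torsion (EllipticEnd Λ) (A.Coker (latticeModule Λ))) :=
    finite_torsion_of_finite_int _
  have hmem : ∀ z ∈ Λ, ∃ m k : ℤ, (m + k * w : ℂ) = z := by
    intro z hz
    rw [hΛ, Submodule.mem_span_pair] at hz
    simpa [zsmul_eq_mul] using hz
  -- The integer `a` carries `Λ` into the multipliers: `a (m + k w) = a m + k θ`.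
  have hmult := l.mult_eq_card_torsion S (r := (a : EllipticEnd Λ))
    (by rw [hΛ]; exact Submodule.subset_span (by simp)) (Int.cast_ne_zero.mpr ha) (by
      intro z hz
      obtain ⟨m, k, rfl⟩ := hmem z hz
      refine ⟨a * m + k * θ, ?_⟩
      rw [Algebra.smul_def]
      simp only [map_mul, map_add, map_intCast, hθ]
      ring)
  have hlat : Nat.card (Submodule.torsion (EllipticEnd Λ) (A.Coker (EllipticEnd Λ)))
      = Nat.card (Submodule.torsion (EllipticEnd Λ) (A.Coker (latticeModule Λ))) := by
    -- Coprimality to the product of both torsion orders makes the comparison injective on torsion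
    -- in both directions.
    obtain ⟨x, y, hxy⟩ := exists_isCoprime_quadratic_form hpqr
      (mul_ne_zero
        (Nat.card_pos (α := Submodule.torsion (EllipticEnd Λ) (A.Coker (EllipticEnd Λ)))).ne'
        (Nat.card_pos (α := Submodule.torsion (EllipticEnd Λ) (A.Coker (latticeModule Λ)))).ne')
    rw [Nat.cast_mul] at hxy
    obtain ⟨f, g, hgf, hfg⟩ := exists_latticeModule_maps hΛ habc hθ x y
    exact A.card_torsion_coker_eq f g _ hgf hfg hxy.of_mul_right_left hxy.of_mul_right_right
  obtain ⟨h1, h2⟩ := hφ.card_torsion_coker_transpose A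
  have e := torsionEquiv (l.matroidObjEquiv S)
  refine ⟨finite_torsion_of_finite_int _, ?_, ?_⟩
  · rw [hmult, ← hlat, ← h1]
    exact (Nat.card_congr e.toEquiv).symm
  · rw [card_fullDual_congr e, h2]
    exact (Nat.card_congr e.toEquiv).symm

/-- For an elliptic curve `E(Λ)` with complex multiplication, the multiplicities of a central elliptic
arrangement are the torsion cardinalities of the realized `End(E(Λ))`-matroid, and the elliptic Tutte
polynomial is the evaluated Grothendieck-Tutte polynomial of that matroid. -/
theorem mainTheorem5 (w : ℂ) (hw : (minpoly ℚ w).natDegree = 2)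
    (Λ : Submodule ℤ ℂ) [DiscreteTopology Λ] [IsZLattice ℝ Λ]
    (hΛ : Λ = Submodule.span ℤ {1, w})
    (d n : ℕ) (l : EllipticArrangement Λ d n) :
    (∀ S : Finset (Fin n), Finite (l.matroid.tor S) ∧ l.mult S = Nat.card (l.matroid.tor S)) ∧
      l.ellipticTutte = l.matroid.tildeTutte := by
  have key := l.card_torsion_of_quadratic w hw Λ hΛ d n
  refine ⟨fun S => ⟨(key S).1, (key S).2.1⟩, ?_⟩
  rw [EllipticArrangement.ellipticTutte, ModuleMatroid.tildeTutte, ModuleMatroid.grothendieckTutte,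
    map_sum]
  refine Finset.sum_congr rfl fun S _ => ?_
  have heval := L0.eval_cls_fullDual (EllipticEnd Λ) (l.matroid.obj S)
  rw [(key S).2.2, ← (key S).2.1] at heval
  rw [map_mul, map_mul, map_pow, map_pow, map_sub, map_sub, MvPolynomial.map_C, MvPolynomial.map_X,
    MvPolynomial.map_X, map_one, heval, l.rank_eq_matroid_rank, l.rank_eq_matroid_rank]
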